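/- Let $p\in(0,1)$, $q=1-p$, and let $\Xi^{(1)},\Xi^{(2)},\dots$ be independent random infinite strings $\Xi^{(j)}=\xi^{(j)}_1\xi^{(j)}_2\cdots$ over $\{0,1\}$ whose letters $\xi^{(j)}_k$ are all independent with $\mathbb P(\xi^{(j)}_k=1)=p$ and $\mathbb P(\xi^{(j)}_k=0)=q$. The trie of a finite set of distinct strings is the binary tree built recursively as follows: no strings give the empty trie; a single string is stored in a single node (the root); if there are at least two strings, there is a root storing no string, the strings whose first letter is $0$ are passed to the left subtree and those whose first letter is $1$ to the right subtree, and the subtrees are constructed by the same procedure, using at each further level the next letter. Let $D_n$ be the depth (distance from the root) of the node containing a given string $\Xi^{(i_n)}$, $1\le i_n\le n$ (for example the first, $i_n=1$), in the trie constructed from $\Xi^{(1)},\dots,\Xi^{(n)}$ (the strings are distinct with probability $1$). Let $$H=-p\ln p-q\ln q,\qquad H_2=p\ln^2p+q\ln^2q,\qquad \sigma^2=H_2-H^2.$$ Then $\sigma^2=pq(\ln p-\ln q)^2=pq\ln^2(p/q)$ and, as $n\to\infty$, $$\frac{D_n-H^{-1}\ln n}{\sqrt{\ln n}}\ \xrightarrow{d}\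 N\Bigl(0,\frac{\sigma^2}{H^3}\Bigr),$$ where $N(0,0)$ is the point mass at $0$. If $p\ne\frac12$, then $\sigma^2>0$ and $D_n\sim\mathrm{AsN}(H^{-1}\ln n,\,H^{-3}\sigma^2\ln n)$, that is, $(D_n-H^{-1}\ln n)/\sqrt{H^{-3}\sigma^2\ln n}\xrightarrow{d}N(0,1)$. Moreover, every $D_n$ has a finite second moment and $$\operatorname{Var}D_n=\frac{\sigma^2}{H^3}\ln n+o(\ln n).$$ -/

import Mathlib

open MeasureTheory ProbabilityTheory Filter Asymptotics

namespace RandomTrie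

/-- Finite binary trees with leaves labelled by `ι`: the empty tree, a single (external) node storing
a label, or a root (internal node, storing nothing) with a left and a right subtree. -/
inductive Trie (ι : Type*) where
  | empty : Trie ι
  | leaf (i : ι) : Trie ι
  | node (l r : Trie ι) : Trie ι

variable {ι : Type*}

/-- `IsTrie s k A t`: starting at the letter with (0-based) position `k`, the recursive trie procedure
applied to the strings `s i`, `i ∈ A`, terminates and produces `t`.
No string gives the empty trie; one string is stored in a single node; for two or more strings there
is a root, the strings whose letter at position `k` is 0 (`false`) are passed to the left subtree, and
those whose letter is 1 (`true`) to the right one, and the subtrees are constructed by the same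
procedure, using the next letter. -/
inductive IsTrie (s : ι → ℕ → Bool) : ℕ → Finset ι → Trie ι → Prop where
  | empty (k : ℕ) : IsTrie s k ∅ Trie.empty
  | leaf (k : ℕ) (i : ι) : IsTrie s k {i} (Trie.leaf i)
  | node (k : ℕ) (A : Finset ι) (l r : Trie ι) (hA : 2 ≤ A.card)
      (hl : IsTrie s (k + 1) (A.filter fun i => s i k = false) l)
      (hr : IsTrie s (k + 1) (A.filter fun i => s i k = true) r) :
      IsTrie s k A (Trie.node l r)

/-- The procedure has at most one result. -/
theorem IsTrie.unique {s : ι → ℕ → Bool} {k : ℕ} {A : Finset ι} {t t' : Trie ι}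
    (h : IsTrie s k A t) (h' : IsTrie s k A t') : t = t' := by
  induction h generalizing t' with
  | empty k =>
    generalize hB : (∅ : Finset ι) = B at h'
    cases h' with
    | empty => rfl
    | leaf i => simp at hB
    | node _ _ _ _ hA => subst hB; simp at hA
  | leaf k i =>
    generalize hB : ({i} : Finset ι) = B at h'
    cases h' with
    | empty => simp at hB
    | leaf j => simp at hB; rw [hB]
    | node _ _ _ _ hA => subst hB; simp at hA
  | node k A l r hA hl hr ihl ihr =>
    cases h' with
    | empty => simp at hA
    | leaf j => simp at hA
    | node _ _ l' r' _ hl' hr' => rw [ihl hl', ihr hr']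

theorem IsTrie.exists_of_bounded (s : ι → ℕ → Bool) (m : ℕ) : ∀ (k : ℕ) (A : Finset ι),
    (∀ i ∈ A, ∀ j ∈ A, i ≠ j → ∃ r, k ≤ r ∧ r < k + m ∧ s i r ≠ s j r) →
    ∃ t, IsTrie s k A t := by
  induction m with
  | zero =>
    intro k A h
    have hA : A.card ≤ 1 := Finset.card_le_one.2 fun i hi j hj => by
      by_contra hij
      obtain ⟨r, h1, h2, -⟩ := h i hi j hj hij
      omega
    rcases Nat.le_one_iff_eq_zero_or_eq_one.1 hA with h0 | h1
    · rw [Finset.card_eq_zero.1 h0]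
      exact ⟨_, IsTrie.empty k⟩
    · obtain ⟨i, rfl⟩ := Finset.card_eq_one.1 h1
      exact ⟨_, IsTrie.leaf k i⟩
  | succ m ih =>
    intro k A h
    rcases Nat.lt_or_ge A.card 2 with hA | hA
    · rcases Nat.le_one_iff_eq_zero_or_eq_one.1 (Nat.le_of_lt_succ hA) with h0 | h1
      · rw [Finset.card_eq_zero.1 h0]
        exact ⟨_, IsTrie.empty k⟩
      · obtain ⟨i, rfl⟩ := Finset.card_eq_one.1 h1
        exact ⟨_, IsTrie.leaf k i⟩
    · have key : ∀ b : Bool, ∃ t, IsTrie s (k + 1) (A.filter fun i => s i k = b) t := by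
        intro b
        refine ih (k + 1) _ fun i hi j hj hij => ?_
        rw [Finset.mem_filter] at hi hj
        obtain ⟨r, h1, h2, h3⟩ := h i hi.1 j hj.1 hij
        have hr : r ≠ k := by
          rintro rfl
          exact h3 (hi.2.trans hj.2.symm)
        exact ⟨r, by omega, by omega, h3⟩
      obtain ⟨l, hl⟩ := key false
      obtain ⟨r, hr⟩ := key true
      exact ⟨_, IsTrie.node k A l r hA hl hr⟩

/-- The procedure terminates on every finite family of distinct strings. -/
theorem IsTrie.exists_of_injOn (s : ι → ℕ → Bool) (A : Finset ι)
    (hs : Set.InjOn s (A : Set ι)) : ∃ t, IsTrie s 0 A t := by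
  classical
  have h : ∀ x : ι × ι, ∃ r, x.1 ∈ A → x.2 ∈ A → x.1 ≠ x.2 → s x.1 r ≠ s x.2 r := by
    rintro ⟨i, j⟩
    by_cases hx : i ∈ A ∧ j ∈ A ∧ i ≠ j
    · obtain ⟨r, hr⟩ := Function.ne_iff.1 fun e => hx.2.2 (hs hx.1 hx.2.1 e)
      exact ⟨r, fun _ _ _ => hr⟩
    · exact ⟨0, fun h1 h2 h3 => absurd ⟨h1, h2, h3⟩ hx⟩
  choose f hf using h
  refine IsTrie.exists_of_bounded s ((A ×ˢ A).sup f + 1) 0 A fun i hi j hj hij =>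
    ⟨f (i, j), Nat.zero_le _, ?_, hf (i, j) hi hj hij⟩
  have : f (i, j) ≤ (A ×ˢ A).sup f := Finset.le_sup (Finset.mk_mem_product hi hj)
  omega

open Classical in
/-- The trie constructed from the strings `s i`, `i ∈ A` (if the strings are not distinct and the
procedure does not terminate, the empty trie by convention). -/
noncomputable def trie (s : ι → ℕ → Bool) (A : Finset ι) : Trie ι :=
  if h : ∃ t, IsTrie s 0 A t then h.choose else Trie.empty

theorem isTrie_trie (s : ι → ℕ → Bool) (A : Finset ι) (hs : Set.InjOn s (A : Set ι)) :
    IsTrie s 0 A (trie s A) := by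
  have h := IsTrie.exists_of_injOn s A hs
  rw [trie, dif_pos h]
  exact h.choose_spec

/-- The depth (distance from the root) of the leaf storing `i`, or `none` if there is no such leaf. -/
def Trie.depth? [DecidableEq ι] (i : ι) : Trie ι → Option ℕ
  | Trie.empty => none
  | Trie.leaf j => if j = i then some 0 else none
  | Trie.node l r => ((l.depth? i).or (r.depth? i)).map (· + 1)

/-- The depth of the node containing the string with label `i` in the trie constructed from
the strings `s 0, …, s (n - 1)` (and `0` if there is no such node). -/
noncomputable def insertionDepth (s : ℕ → ℕ → Bool) (n i : ℕ) : ℕ :=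
  ((trie s (Finset.range n)).depth? i).getD 0

/-- The second moment `H₂ = p ln² p + q ln² q`, `q = 1 - p`. -/
noncomputable def secondMoment (p : ℝ) : ℝ :=
  p * Real.log p ^ 2 + (1 - p) * Real.log (1 - p) ^ 2

/-- `σ² = H₂ - H²`, where `H = -p ln p - q ln q` is the entropy `Real.binEntropy p`. -/
noncomputable def sigmaSq (p : ℝ) : ℝ :=
  secondMoment p - Real.binEntropy p ^ 2

/-- `Z n ∼ AsN(m n, v n)`: the variances `v n` are positive for large `n`, and
`(Z n - m n) / √(v n)` converges in distribution to the standard normal law. -/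
def AsN {Ω : Type*} [MeasurableSpace Ω] (P : Measure Ω) [IsProbabilityMeasure P]
    (Z : ℕ → Ω → ℝ) (m v : ℕ → ℝ) : Prop :=
  (∀ᶠ n in atTop, 0 < v n) ∧
    TendstoInDistribution (fun n ω => (Z n ω - m n) / √(v n)) atTop (id : ℝ → ℝ)
      (fun _ => P) (gaussianReal 0 1)

end RandomTrie

namespace RandomTrie

/-! ### Depth in a trie as a separation time -/

variable {ι : Type*}

/-! The depth of a string in the trie is the least `k` such that its first `k` letters differ from
the first `k` letters of every other string (`insertionDepth_eq_separationDepth`). Give each letter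
`b` the weight `c b = -ln β{b}`, its information content, where `β` is the law of a letter; under
`β` it has mean `H` and variance `σ²`. If the given string is `x` and `S_k` is the sum of the
weights of its first `k` letters, another string shares this prefix with probability `exp (-S_k)`.
Hence, conditionally on `x`, the depth is at most `k` with probability `(1 - exp (-S_k)) ^ (n - 1)`
(`measure_separated`). This jumps from near 0 to near 1 as `S_k` crosses `ln n`, so the depth
differs from the passage time `V` of `S` at level `a = ln n` by an error with exponential tails,
bounded in L² uniformly in `n` (`measure_tail_le`, `exists_lintegral_sq_sub_le`).

The rest is renewal theory for a random walk with bounded positive steps. Let `m = ⌊a / H⌋` and let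
`M = S_m - m H` be the centred sum. The overshoot `S_V - a` is bounded, so `H V - a + M` is, up to a
bounded term, minus the increment of the centred walk between the times `m` and `V`. That increment
is a martingale transform with second moment `σ² E|V - m|` (`integral_passage_transform_sq`), and
`E|V - m| = O(√a + 1)` follows from the same identity by absorption. Therefore `E (H D - ln n + M)²
= O(√(ln n) + 1)` (`exists_integral_depth_add_weightSum_sq_le`).

This estimate gives both conclusions. Divided by `ln n` it tends to 0, so the normalised depth has
the limit of `-H⁻¹ M / √(ln n)`, found from the central limit theorem and `m / ln n → H⁻¹`. And `Var
M = σ² m`, while the error changes the variance of `H D` by only `o(ln n)`. -/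

theorem IsTrie.depth?_eq_none [DecidableEq ι] {s : ι → ℕ → Bool} {k : ℕ} {A : Finset ι} {t : Trie ι}
    (h : IsTrie s k A t) {i : ι} (hi : i ∉ A) : t.depth? i = none := by
  induction h with
  | empty k => rfl
  | leaf k j =>
    have : j ≠ i := fun e => hi (by simp [e])
    simp [Trie.depth?, this]
  | node k A l r hA hl hr ihl ihr =>
    simp [Trie.depth?, ihl (fun h => hi (Finset.mem_of_mem_filter i h)),
      ihr (fun h => hi (Finset.mem_of_mem_filter i h))]

/-- In a trie started at letter `k`, the leaf storing `i` has depth at most `m` if and only if the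
`m` letters from position `k` on separate the string of `i` from all other strings. -/
theorem IsTrie.exists_depth?_eq_some [DecidableEq ι] {s : ι → ℕ → Bool} {k : ℕ} {A : Finset ι}
    {t : Trie ι} (h : IsTrie s k A t) {i : ι} (hi : i ∈ A) :
    ∃ d, t.depth? i = some d ∧
      ∀ m, d ≤ m ↔ ∀ j ∈ A, j ≠ i → ∃ r, k ≤ r ∧ r < k + m ∧ s j r ≠ s i r := by
  induction h with
  | empty k => simp at hi
  | leaf k j =>
    obtain rfl : i = j := by simpa using hi
    refine ⟨0, by simp [Trie.depth?], fun m => ⟨fun _ j hj hji => ?_, fun _ => Nat.zero_le _⟩⟩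
    exact absurd (by simpa using hj) hji
  | node k A l r hA hl hr ihl ihr =>
    -- Strings sent to the other subtree are already separated by the letter at `k`, so only those
    -- in the subtree of `i` impose a condition on later letters.
    have key : ∀ (b : Bool) (t : Trie ι) (d : ℕ), s i k = b →
        (∀ m, d ≤ m ↔ ∀ j ∈ A.filter (fun i => s i k = b), j ≠ i →
          ∃ r, k + 1 ≤ r ∧ r < k + 1 + m ∧ s j r ≠ s i r) →
        ∀ m, d + 1 ≤ m ↔ ∀ j ∈ A, j ≠ i → ∃ r, k ≤ r ∧ r < k + m ∧ s j r ≠ s i r := by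
      intro b t d hb hd m
      constructor
      · intro hm j hj hji
        by_cases hjk : s j k = b
        · obtain ⟨r, h1, h2, h3⟩ := (hd (m - 1)).1 (by omega) j (by simp [hj, hjk]) hji
          exact ⟨r, by omega, by omega, h3⟩
        · exact ⟨k, le_rfl, by omega, by rwa [hb]⟩
      · intro hm
        -- A root has a second string below it, and zero letters separate nothing.
        have hm0 : m ≠ 0 := by
          rintro rfl
          obtain ⟨j, hj, hji⟩ := Finset.exists_mem_ne (Nat.lt_of_lt_of_le one_lt_two hA) i
          obtain ⟨r, h1, h2, -⟩ := hm j hj hji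
          omega
        have := (hd (m - 1)).2 fun j hj hji => by
          rw [Finset.mem_filter] at hj
          obtain ⟨r, h1, h2, h3⟩ := hm j hj.1 hji
          have : r ≠ k := by
            rintro rfl
            exact h3 (hj.2.trans hb.symm)
          exact ⟨r, by omega, by omega, h3⟩
        omega
    cases hb : s i k with
    | false =>
      obtain ⟨d, h1, h2⟩ := ihl (by simp [hi, hb])
      refine ⟨d + 1, ?_, key false l d hb h2⟩
      simp [Trie.depth?, h1]
    | true =>
      obtain ⟨d, h1, h2⟩ := ihr (by simp [hi, hb])
      refine ⟨d + 1, ?_, key true r d hb h2⟩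
      -- The search tries the left subtree first, so it must be known to fail there.
      have : l.depth? i = none := hl.depth?_eq_none (by simp [hb])
      simp [Trie.depth?, h1, this]

/-- The number of letters needed to separate the string `s i` from the other strings `s j`,
`j ∈ A`. -/
noncomputable def separationDepth (s : ι → ℕ → Bool) (A : Finset ι) (i : ι) : ℕ :=
  sInf {k | ∀ j ∈ A, j ≠ i → ∃ r < k, s j r ≠ s i r}

theorem exists_separating {s : ι → ℕ → Bool} {A : Finset ι} (hs : Set.InjOn s (A : Set ι))
    {i : ι} (hi : i ∈ A) : ∃ k, ∀ j ∈ A, j ≠ i → ∃ r < k, s j r ≠ s i r := by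
  classical
  obtain ⟨d, -, h⟩ := (isTrie_trie s A hs).exists_depth?_eq_some hi
  exact ⟨d, by simpa using (h d).1 le_rfl⟩

theorem separationDepth_le_iff {s : ι → ℕ → Bool} {A : Finset ι} (hs : Set.InjOn s (A : Set ι))
    {i : ι} (hi : i ∈ A) (k : ℕ) :
    separationDepth s A i ≤ k ↔ ∀ j ∈ A, j ≠ i → ∃ r < k, s j r ≠ s i r := by
  constructor
  · intro hk j hj hji
    obtain ⟨r, h1, h2⟩ := Nat.sInf_mem (exists_separating hs hi) j hj hji
    exact ⟨r, h1.trans_le hk, h2⟩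
  · exact fun h => Nat.sInf_le h

theorem insertionDepth_eq_separationDepth {s : ℕ → ℕ → Bool} {n i : ℕ}
    (hs : Set.InjOn s (Finset.range n : Set ℕ)) (hi : i < n) :
    insertionDepth s n i = separationDepth s (Finset.range n) i := by
  have hi' := Finset.mem_range.2 hi
  obtain ⟨d, h1, h2⟩ := (isTrie_trie s _ hs).exists_depth?_eq_some hi'
  rw [insertionDepth, h1, Option.getD_some]
  refine eq_of_forall_ge_iff fun k => ?_
  rw [h2, separationDepth_le_iff hs hi']
  simp

/-- For `n = 0` nothing is assumed about the label, yet a finite second moment is claimed for every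
`n`. -/
theorem insertionDepth_zero (s : ℕ → ℕ → Bool) (i : ℕ) : insertionDepth s 0 i = 0 := by
  have h := isTrie_trie s (Finset.range 0) (by simp)
  rw [insertionDepth, h.depth?_eq_none (by simp), Option.getD_none]

theorem measurable_separationDepth {Ω : Type*} [MeasurableSpace Ω] {s : Ω → ι → ℕ → Bool}
    (hs : ∀ j r, Measurable fun ω => s ω j r) (A : Finset ι) (i : ι) :
    Measurable fun ω => separationDepth (s ω) A i := by
  classical
  set p : Ω → ℕ → Prop := fun ω k => ∀ j ∈ A, j ≠ i → ∃ r < k, s ω j r ≠ s ω i r with hp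
  have hm : ∀ k, MeasurableSet {ω | p ω k} := fun k => by
    have : {ω | p ω k} = ⋂ j ∈ A, ⋂ (_ : j ≠ i), ⋃ r ∈ Finset.range k, {ω | s ω j r = s ω i r}ᶜ := by
      ext ω; simp [hp]
    rw [this]
    refine Finset.measurableSet_biInter _ fun j _ => MeasurableSet.iInter fun _ =>
      Finset.measurableSet_biUnion _ fun r _ => ?_
    exact (measurableSet_eq_fun (hs j r) (hs i r)).compl
  -- The second alternative makes the predicate satisfiable even for strings that are never
  -- separated; its least witness is then 0, the value of `sInf ∅`.
  have hq : ∀ ω, ∃ k, p ω k ∨ ∀ l, ¬ p ω l := fun ω => by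
    by_cases h : ∃ k, p ω k
    · exact h.imp fun k => Or.inl
    · exact ⟨0, Or.inr (not_exists.1 h)⟩
  have hfind : (fun ω => separationDepth (s ω) A i) = fun ω => Nat.find (hq ω) := by
    funext ω
    by_cases h : ∃ k, p ω k
    · refine ((Nat.find_eq_iff (hq ω)).2 ⟨Or.inl (Nat.sInf_mem h), fun l hl => ?_⟩).symm
      exact not_or.2 ⟨fun h' => Nat.notMem_of_lt_sInf hl h', fun h' => h.elim h'⟩
    · have h1 : {k | p ω k} = ∅ := by ext k; simpa using not_exists.1 h k
      change sInf {k | p ω k} = _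
      rw [h1, Nat.sInf_empty, eq_comm, Nat.find_eq_zero]
      exact Or.inr (not_exists.1 h)
  rw [hfind]
  refine measurable_find hq fun k => ?_
  rw [Set.ofPred_or]
  refine (hm k).union ?_
  rw [Set.ofPred_forall]
  exact MeasurableSet.iInter fun l => (hm l).compl

/-! ### Functions of finitely many letters -/

section Prefix

variable {E : Type*} {k K : ℕ}

theorem dependsOn_range_mono {f : (ℕ → Bool) → E} (hf : DependsOn f (Finset.range k : Set ℕ))
    (h : k ≤ K) : DependsOn f (Finset.range K : Set ℕ) :=
  hf.mono (by simpa using h)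

/-- Extension of a finite word by the letter 0. -/
def extendWord (k : ℕ) (y : Finset.range k → Bool) (r : ℕ) : Bool :=
  if h : r ∈ Finset.range k then y ⟨r, h⟩ else false

/-- Such a function factors through the finite set of words of length `k`. Measurability,
boundedness and integrability of everything built from the walk up to a bounded time come from this.
-/
theorem DependsOn.eq_extendWord {f : (ℕ → Bool) → E}
    (hf : DependsOn f (Finset.range k : Set ℕ)) (x : ℕ → Bool) :
    f x = f (extendWord k ((Finset.range k).restrict x)) :=
  hf fun r hr => by
    have hr' : r ∈ Finset.range k := hr
    rw [extendWord, dif_pos hr', Finset.restrict]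

theorem DependsOn.measurable_of_range [MeasurableSpace E] {f : (ℕ → Bool) → E}
    (hf : DependsOn f (Finset.range k : Set ℕ)) : Measurable f := by
  have h : f = (fun y => f (extendWord k y)) ∘ (Finset.range k).restrict :=
    funext fun x => DependsOn.eq_extendWord hf x
  rw [h]
  exact (measurable_of_finite _).comp (Finset.measurable_restrict _)

theorem DependsOn.exists_bound {f : (ℕ → Bool) → ℝ}
    (hf : DependsOn f (Finset.range k : Set ℕ)) : ∃ C, ∀ x, ‖f x‖ ≤ C := by
  obtain ⟨C, hC⟩ := (Set.finite_range fun y => ‖f (extendWord k y)‖).bddAbove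
  refine ⟨C, fun x => ?_⟩
  rw [DependsOn.eq_extendWord hf x]
  exact hC ⟨_, rfl⟩

theorem DependsOn.memLp_of_range {μ : Measure (ℕ → Bool)} [IsFiniteMeasure μ]
    {f : (ℕ → Bool) → ℝ} (hf : DependsOn f (Finset.range k : Set ℕ)) (q : ENNReal) :
    MemLp f q μ := by
  obtain ⟨C, hC⟩ := DependsOn.exists_bound hf
  exact MemLp.of_bound (DependsOn.measurable_of_range hf).aestronglyMeasurable C (ae_of_all _ hC)

theorem DependsOn.integrable_of_range {μ : Measure (ℕ → Bool)} [IsFiniteMeasure μ]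
    {f : (ℕ → Bool) → ℝ} (hf : DependsOn f (Finset.range k : Set ℕ)) : Integrable f μ :=
  (DependsOn.memLp_of_range hf 1).integrable le_rfl

end Prefix

/-! ### Independent letters and martingale transforms -/

/-- The law of an infinite string of independent letters with law `β`. -/
noncomputable def stringLaw (β : Measure Bool) [IsProbabilityMeasure β] : Measure (ℕ → Bool) :=
  Measure.infinitePi fun _ => β

section StringLaw

variable (β : Measure Bool) [IsProbabilityMeasure β]

instance : IsProbabilityMeasure (stringLaw β) := by
  unfold stringLaw; infer_instance

theorem iIndepFun_letter : iIndepFun (fun (r : ℕ) (x : ℕ → Bool) => x r) (stringLaw β) :=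
  iIndepFun_infinitePi (P := fun _ : ℕ => β) (X := fun _ b => b) fun _ => measurable_id

theorem map_letter (r : ℕ) : (stringLaw β).map (fun x => x r) = β :=
  Measure.infinitePi_map_eval (fun _ : ℕ => β) r

theorem integral_letter (g : Bool → ℝ) (r : ℕ) : ∫ x, g (x r) ∂stringLaw β = ∫ b, g b ∂β := by
  rw [← integral_map (φ := fun x : ℕ → Bool => x r) (measurable_pi_apply r).aemeasurable
    (measurable_of_finite g).aestronglyMeasurable, map_letter]

theorem integral_prefix_mul_letter {K : ℕ} {f : (ℕ → Bool) → ℝ}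
    (hf : DependsOn f (Finset.range K : Set ℕ)) (g : Bool → ℝ) :
    ∫ x, f x * g (x K) ∂stringLaw β = (∫ x, f x ∂stringLaw β) * ∫ b, g b ∂β := by
  have h := (iIndepFun_letter β).indepFun_finset (Finset.range K) {K} (by simp)
    fun r => measurable_pi_apply r
  have h2 : IndepFun f (fun x : ℕ → Bool => g (x K)) (stringLaw β) := by
    have := h.comp (φ := fun y => f (extendWord K y)) (ψ := fun y => g (y ⟨K, by simp⟩))
      (measurable_of_finite _) (measurable_of_finite _)
    have e : f = (fun y => f (extendWord K y)) ∘ (Finset.range K).restrict :=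
      funext fun x => DependsOn.eq_extendWord hf x
    rw [e]
    exact this
  rw [h2.integral_fun_mul_eq_mul_integral (DependsOn.measurable_of_range hf).aestronglyMeasurable
    ((measurable_of_finite g).comp (measurable_pi_apply K)).aestronglyMeasurable, integral_letter]

/-- Orthogonality of the increments of a martingale transform. -/
theorem integral_sum_prefix_mul_letter_sq {f : ℕ → (ℕ → Bool) → ℝ}
    (hf : ∀ k, DependsOn (f k) (Finset.range k : Set ℕ)) {g : Bool → ℝ} (hg : ∫ b, g b ∂β = 0)
    (K : ℕ) :
    ∫ x, (∑ k ∈ Finset.range K, f k x * g (x k)) ^ 2 ∂stringLaw β =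
      (∫ b, g b ^ 2 ∂β) * ∑ k ∈ Finset.range K, ∫ x, f k x ^ 2 ∂stringLaw β := by
  have hS : ∀ K, DependsOn (fun x => ∑ k ∈ Finset.range K, f k x * g (x k))
      (Finset.range K : Set ℕ) := fun K x y hxy =>
    Finset.sum_congr rfl fun k hk => by
      rw [hf k fun r hr => hxy r _, hxy k hk]
      simp only [Finset.coe_range, Set.mem_Iio, Finset.mem_range] at *
      omega
  induction K with
  | zero => simp
  | succ K ih =>
    have hI1 := DependsOn.integrable_of_range (μ := stringLaw β) (k := K)
      (f := fun x => (∑ k ∈ Finset.range K, f k x * g (x k)) ^ 2)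
      fun x y hxy => by simp only [hS K hxy]
    have hd2 : DependsOn (fun x => (∑ k ∈ Finset.range K, f k x * g (x k)) * f K x)
        (Finset.range K : Set ℕ) := fun x y hxy => by
      have := hS K hxy
      simp only at this ⊢
      rw [this, hf K hxy]
    have hd3 : DependsOn (fun x => f K x ^ 2) (Finset.range K : Set ℕ) := fun x y hxy => by
      simp only [hf K hxy]
    have hlet : DependsOn (fun x : ℕ → Bool => g (x K)) (Finset.range (K + 1) : Set ℕ) :=
      fun x y hxy => by simp only [hxy K (by simp)]
    have hI2 := DependsOn.integrable_of_range (μ := stringLaw β) (k := K + 1)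
      (f := fun x => (∑ k ∈ Finset.range K, f k x * g (x k)) * f K x * g (x K))
      fun x y hxy => by
        have h1 := dependsOn_range_mono hd2 K.le_succ hxy
        have h2 := hlet hxy
        simp only at h1 h2 ⊢
        rw [h1, h2]
    have hI3 := DependsOn.integrable_of_range (μ := stringLaw β) (k := K + 1)
      (f := fun x => f K x ^ 2 * g (x K) ^ 2)
      fun x y hxy => by
        have h1 := dependsOn_range_mono hd3 K.le_succ hxy
        have h2 := hlet hxy
        simp only at h1 h2 ⊢
        rw [h1, h2]
    -- The cross term is a function of the first `K` letters times `g (x K)`, which is independent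
    -- of them and has mean zero.
    have e : ∀ x : ℕ → Bool, (∑ k ∈ Finset.range (K + 1), f k x * g (x k)) ^ 2 =
        (∑ k ∈ Finset.range K, f k x * g (x k)) ^ 2 +
        2 * ((∑ k ∈ Finset.range K, f k x * g (x k)) * f K x * g (x K)) +
        f K x ^ 2 * g (x K) ^ 2 := fun x => by
      rw [Finset.sum_range_succ]; ring
    simp_rw [e]
    have hI12 : Integrable (fun x => (∑ k ∈ Finset.range K, f k x * g (x k)) ^ 2 +
        2 * ((∑ k ∈ Finset.range K, f k x * g (x k)) * f K x * g (x K))) (stringLaw β) :=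
      hI1.add (hI2.const_mul 2)
    rw [integral_add hI12 hI3, integral_add hI1 (hI2.const_mul 2),
      integral_const_mul, integral_prefix_mul_letter β hd2 g, hg,
      integral_prefix_mul_letter β hd3 (fun b => g b ^ 2), ih, Finset.sum_range_succ]
    ring

end StringLaw

/-! ### The walk of weights and its passage times -/

/-- The partial sums of the weights `c` of the letters of a string. -/
def weightSum (c : Bool → ℝ) (x : ℕ → Bool) (k : ℕ) : ℝ := ∑ r ∈ Finset.range k, c (x r)

/-- The first time that the weight sums reach the level `a`. -/
noncomputable def passage (c : Bool → ℝ) (a : ℝ) (x : ℕ → Bool) : ℕ :=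
  sInf {k | a ≤ weightSum c x k}

section Passage

variable {c : Bool → ℝ} {γ Γ : ℝ}

theorem dependsOn_weightSum (c : Bool → ℝ) (k : ℕ) :
    DependsOn (fun x => weightSum c x k) (Finset.range k : Set ℕ) := fun x y hxy =>
  Finset.sum_congr rfl fun r hr => by rw [hxy r hr]

theorem weightSum_succ (c : Bool → ℝ) (x : ℕ → Bool) (k : ℕ) :
    weightSum c x (k + 1) = weightSum c x k + c (x k) :=
  Finset.sum_range_succ _ _

theorem weightSum_zero (c : Bool → ℝ) (x : ℕ → Bool) : weightSum c x 0 = 0 :=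
  Finset.sum_range_zero _

theorem weightSum_add_le (hc : ∀ b, γ ≤ c b) (x : ℕ → Bool) (k r : ℕ) :
    weightSum c x k + γ * r ≤ weightSum c x (k + r) := by
  induction r with
  | zero => simp
  | succ r ih =>
    rw [← add_assoc, weightSum_succ]
    push_cast
    linarith [hc (x (k + r))]

theorem mul_le_weightSum (hc : ∀ b, γ ≤ c b) (x : ℕ → Bool) (k : ℕ) : γ * k ≤ weightSum c x k := by
  simpa [weightSum_zero] using weightSum_add_le hc x 0 k

theorem weightSum_mono (hγ : 0 < γ) (hc : ∀ b, γ ≤ c b) (x : ℕ → Bool) : Monotone (weightSum c x) :=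
  monotone_nat_of_le_succ fun k => by
    rw [weightSum_succ]; linarith [hc (x k)]

theorem le_weightSum_ceil (hγ : 0 < γ) (hc : ∀ b, γ ≤ c b) (a : ℝ) (x : ℕ → Bool) : a ≤ weightSum c x ⌈a / γ⌉₊ := by
  refine le_trans ?_ (mul_le_weightSum hc x _)
  have := Nat.le_ceil (a / γ)
  rwa [div_le_iff₀' hγ] at this

theorem le_weightSum_passage (hγ : 0 < γ) (hc : ∀ b, γ ≤ c b) (a : ℝ) (x : ℕ → Bool) : a ≤ weightSum c x (passage c a x) :=
  Nat.sInf_mem (s := {k | a ≤ weightSum c x k}) ⟨_, le_weightSum_ceil hγ hc a x⟩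

theorem passage_le_ceil (hγ : 0 < γ) (hc : ∀ b, γ ≤ c b) (a : ℝ) (x : ℕ → Bool) : passage c a x ≤ ⌈a / γ⌉₊ :=
  Nat.sInf_le (le_weightSum_ceil hγ hc a x)

/-- The walk is increasing. The point is that `k < passage c a x` is decided by the first `k`
letters, which makes its indicator predictable. -/
theorem lt_passage_iff (hγ : 0 < γ) (hc : ∀ b, γ ≤ c b) (a : ℝ) (x : ℕ → Bool) (k : ℕ) :
    k < passage c a x ↔ weightSum c x k < a := by
  constructor
  · exact fun h => not_le.1 (Nat.notMem_of_lt_sInf h)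
  · intro h
    by_contra! h'
    exact absurd ((le_weightSum_passage hγ hc a x).trans (weightSum_mono hγ hc x h')) h.not_ge

/-- The overshoot is at most the last step. -/
theorem weightSum_passage_le (hγ : 0 < γ) (hc : ∀ b, γ ≤ c b) (hΓ : ∀ b, c b ≤ Γ) {a : ℝ} (ha : 0 ≤ a) (x : ℕ → Bool) :
    weightSum c x (passage c a x) ≤ a + Γ := by
  rcases h : passage c a x with _ | k
  · rw [weightSum_zero]
    linarith [hc true, hΓ true]
  · have := (lt_passage_iff hγ hc a x k).1 (by omega)
    rw [weightSum_succ]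
    linarith [hΓ (x k)]

/-- Steps of size at least `γ > 0` bound the passage time deterministically by `⌈a / γ⌉₊`. -/
theorem dependsOn_passage (hγ : 0 < γ) (hc : ∀ b, γ ≤ c b) (a : ℝ) :
    DependsOn (passage c a) (Finset.range ⌈a / γ⌉₊ : Set ℕ) := fun x y hxy => by
  refine eq_of_forall_lt_iff fun k => ?_
  rcases lt_or_ge k ⌈a / γ⌉₊ with hk | hk
  · rw [lt_passage_iff hγ hc, lt_passage_iff hγ hc]
    have := dependsOn_range_mono (dependsOn_weightSum c k) hk.le hxy
    simp only at this
    rw [this]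
  · have h1 := passage_le_ceil hγ hc a x
    have h2 := passage_le_ceil hγ hc a y
    exact iff_of_false (by omega) (by omega)

variable (β : Measure Bool) [IsProbabilityMeasure β]

theorem integral_sub_mean (c : Bool → ℝ) : ∫ b, (c b - ∫ b, c b ∂β) ∂β = 0 := by
  rw [integral_sub Integrable.of_finite (integrable_const _), integral_const, probReal_univ,
    one_smul, sub_self]

theorem integral_weightSum_sub_sq (k : ℕ) :
    ∫ x, (weightSum c x k - k * ∫ b, c b ∂β) ^ 2 ∂stringLaw β = Var[c; β] * k := by
  have h := integral_sum_prefix_mul_letter_sq β (f := fun _ _ => 1)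
    (fun k => fun _ _ _ => rfl) (g := fun b => c b - ∫ b, c b ∂β)
    (integral_sub_mean β c) k
  rw [variance_eq_integral (measurable_of_finite c).aemeasurable]
  simpa [weightSum] using h

/-- The difference of the centred walk at the times `passage` and `m` is the transform of the
centred steps by the predictable factors `1{k < passage} - 1{k < m}`. The squares of these factors
add up to `|passage - m|`. -/
theorem integral_passage_transform_sq (hγ : 0 < γ) (hc : ∀ b, γ ≤ c b) (a : ℝ) (m : ℕ) :
    ∫ x, ((weightSum c x (passage c a x) - passage c a x * ∫ b, c b ∂β)
      - (weightSum c x m - m * ∫ b, c b ∂β)) ^ 2 ∂stringLaw β =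
    Var[c; β] * ∫ x, |(passage c a x : ℝ) - m| ∂stringLaw β := by
  classical
  set H := ∫ b, c b ∂β with hH
  set K := max ⌈a / γ⌉₊ m with hK
  set f : ℕ → (ℕ → Bool) → ℝ := fun k x =>
    (if weightSum c x k < a then 1 else 0) - (if k < m then 1 else 0) with hfdef
  have hf : ∀ k, DependsOn (f k) (Finset.range k : Set ℕ) := fun k x y hxy => by
    have := dependsOn_weightSum c k hxy
    simp only at this
    simp only [hfdef, this]
  have h := integral_sum_prefix_mul_letter_sq β hf (g := fun b => c b - H)
    (integral_sub_mean β c) K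
  have hind : ∀ (N : ℕ) (u : ℕ → ℝ), N ≤ K →
      ∑ k ∈ Finset.range K, (if k < N then (1 : ℝ) else 0) * u k = ∑ k ∈ Finset.range N, u k := by
    intro N u hN
    simp only [ite_mul, one_mul, zero_mul]
    rw [← Finset.sum_filter]
    congr 1
    ext k
    simp only [Finset.mem_filter, Finset.mem_range]
    omega
  have hpK : ∀ x, passage c a x ≤ K := fun x =>
    (passage_le_ceil hγ hc a x).trans (le_max_left _ _)
  have hmK : m ≤ K := le_max_right _ _
  have hf' : ∀ k x, f k x = (if k < passage c a x then 1 else 0) - (if k < m then 1 else 0) :=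
    fun k x => by simp only [hfdef, lt_passage_iff hγ hc]
  have e1 : ∀ x, ∑ k ∈ Finset.range K, f k x * (c (x k) - H) =
      (weightSum c x (passage c a x) - passage c a x * H) - (weightSum c x m - m * H) := by
    intro x
    simp only [hf', sub_mul (_ : ℝ) _ (c _ - H), Finset.sum_sub_distrib]
    rw [hind _ _ (hpK x), hind _ _ hmK]
    simp [weightSum]
  have e2 : ∀ x, ∑ k ∈ Finset.range K, f k x ^ 2 = |(passage c a x : ℝ) - m| := by
    intro x
    rcases le_total (passage c a x) m with hle | hle
    · have e : ∀ k, f k x ^ 2 = (if k < m then (1 : ℝ) else 0) * 1 -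
          (if k < passage c a x then 1 else 0) * 1 := fun k => by
        rw [hf']
        split_ifs <;> first | omega | norm_num
      simp only [e, Finset.sum_sub_distrib]
      rw [hind _ _ (hpK x), hind _ _ hmK, abs_sub_comm, abs_of_nonneg]
      · simp
      · simpa using hle
    · have e : ∀ k, f k x ^ 2 = (if k < passage c a x then (1 : ℝ) else 0) * 1 -
          (if k < m then 1 else 0) * 1 := fun k => by
        rw [hf']
        split_ifs <;> first | omega | norm_num
      simp only [e, Finset.sum_sub_distrib]
      rw [hind _ _ (hpK x), hind _ _ hmK, abs_of_nonneg]
      · simp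
      · simpa using hle
  rw [← integral_finsetSum _ fun k _ => DependsOn.integrable_of_range (k := k)
    fun x y hxy => by simp only [hf k hxy]] at h
  simp only [e1, e2] at h
  rw [h, variance_eq_integral (measurable_of_finite c).aemeasurable]

end Passage

/-! ### Separation depth versus passage time at level `ln n` -/

/-- The information content `-ln β{b}` of the letter `b`. -/
noncomputable def letterWeight (β : Measure Bool) (b : Bool) : ℝ := -Real.log (β.real {b})

section

variable {β : Measure Bool} [IsProbabilityMeasure β]

theorem measure_singleton_eq_exp (hβ : ∀ b, 0 < β.real {b}) (b : Bool) :
    β {b} = ENNReal.ofReal (Real.exp (-letterWeight β b)) := by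
  rw [letterWeight, neg_neg, Real.exp_log (hβ b), ofReal_measureReal]

theorem stringLaw_prefix (hβ : ∀ b, 0 < β.real {b}) (x : ℕ → Bool) (k : ℕ) :
    stringLaw β {y | ∀ r < k, y r = x r} =
      ENNReal.ofReal (Real.exp (-weightSum (letterWeight β) x k)) := by
  have h : {y : ℕ → Bool | ∀ r < k, y r = x r} =
      Set.pi (Finset.range k : Set ℕ) fun r => {x r} := by
    ext y; simp [Set.mem_pi]
  rw [h, stringLaw, Measure.infinitePi_pi _ fun r _ => MeasurableSet.singleton _]
  simp_rw [measure_singleton_eq_exp hβ]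
  rw [← ENNReal.ofReal_prod_of_nonneg fun r _ => (Real.exp_pos _).le, ← Real.exp_sum,
    weightSum, Finset.sum_neg_distrib]

theorem measurableSet_prefix (x : ℕ → Bool) (k : ℕ) :
    MeasurableSet {y : ℕ → Bool | ∀ r < k, y r = x r} := by
  have : {y : ℕ → Bool | ∀ r < k, y r = x r} = ⋂ r ∈ Finset.range k, {y | y r = x r} := by
    ext y; simp
  rw [this]
  exact Finset.measurableSet_biInter _ fun r _ =>
    measurableSet_eq_fun (measurable_pi_apply r) measurable_const

theorem stringLaw_separated (hβ : ∀ b, 0 < β.real {b}) (x : ℕ → Bool) (k : ℕ) :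
    stringLaw β {y | ∃ r < k, y r ≠ x r} =
      ENNReal.ofReal (1 - Real.exp (-weightSum (letterWeight β) x k)) := by
  have h : {y : ℕ → Bool | ∃ r < k, y r ≠ x r} = {y | ∀ r < k, y r = x r}ᶜ := by
    ext y; simp
  rw [h, prob_compl_eq_one_sub (measurableSet_prefix x k), stringLaw_prefix hβ,
    ENNReal.ofReal_sub _ (Real.exp_pos _).le, ENNReal.ofReal_one]

end

section Rows

variable {Ω : Type*} [MeasurableSpace Ω] {P : Measure Ω} [IsProbabilityMeasure P]
  {β : Measure Bool} [IsProbabilityMeasure β] {R : ℕ → Ω → ℕ → Bool}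

/-- Conditioning on row `i` (Fubini) leaves independent rows, each separated from the fixed string
`x` with the same probability. The length `l` may depend on row `i`, so that random times near the
passage time can be inserted. -/
theorem measure_separated (hβ : ∀ b, 0 < β.real {b}) (hR : ∀ j, Measurable (R j))
    (hind : iIndepFun R P) (hlaw : ∀ j, P.map (R j) = stringLaw β) {i : ℕ} {s : Finset ℕ}
    (hi : i ∉ s) {l : (ℕ → Bool) → ℕ} (hl : Measurable l) :
    P {ω | ∀ j ∈ s, ∃ r < l (R i ω), R j ω r ≠ R i ω r} =
      ∫⁻ x, ENNReal.ofReal ((1 - Real.exp (-weightSum (letterWeight β) x (l x))) ^ s.card)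
        ∂stringLaw β := by
  have h1 : IndepFun (R i) (fun ω (j : s) => R j ω) P := by
    have hφ : Measurable fun y : ({i} : Finset ℕ) → ℕ → Bool => y ⟨i, by simp⟩ :=
      measurable_pi_apply _
    exact (hind.indepFun_finset {i} s (by simpa using hi) hR).comp hφ measurable_id
  have hRs : Measurable fun ω (j : s) => R j ω := measurable_pi_lambda _ fun j => hR j
  have h2 : P.map (fun ω (j : s) => R j ω) = Measure.pi fun _ : s => stringLaw β := by
    rw [(iIndepFun_iff_map_fun_eq_pi_map fun j : s => (hR j).aemeasurable).1
      (hind.precomp (g := ((↑) : s → ℕ)) Subtype.val_injective)]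
    simp_rw [hlaw]
  have h3 := (indepFun_iff_map_prod_eq_prod_map_map (hR i).aemeasurable hRs.aemeasurable).1 h1
  rw [hlaw, h2] at h3
  set T : Set ((ℕ → Bool) × (s → ℕ → Bool)) := {z | ∀ j, ∃ r < l z.1, z.2 j r ≠ z.1 r} with hT
  have hTm : MeasurableSet T := by
    have : T = ⋂ j, ⋃ r, {z | r < l z.1} ∩ {z | z.2 j r = z.1 r}ᶜ := by
      ext z; simp [hT]
    rw [this]
    refine MeasurableSet.iInter fun j => MeasurableSet.iUnion fun r => MeasurableSet.inter ?_ ?_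
    · exact measurableSet_lt measurable_const (hl.comp measurable_fst)
    · exact (measurableSet_eq_fun
        ((measurable_pi_apply r).comp ((measurable_pi_apply j).comp measurable_snd))
        ((measurable_pi_apply r).comp measurable_fst)).compl
  have h4 : {ω | ∀ j ∈ s, ∃ r < l (R i ω), R j ω r ≠ R i ω r} =
      (fun ω => (R i ω, fun j : s => R j ω)) ⁻¹' T := by
    ext ω; simp [hT]
  rw [h4, ← Measure.map_apply ((hR i).prodMk hRs) hTm, h3, Measure.prod_apply hTm]
  refine lintegral_congr fun x => ?_
  have h5 : Prod.mk x ⁻¹' T = Set.pi Set.univ fun _ : s => {y | ∃ r < l x, y r ≠ x r} := by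
    ext z; simp [hT, Set.mem_pi]
  rw [h5, Measure.pi_pi]
  simp only [stringLaw_separated hβ, Finset.prod_const, Finset.card_univ, Fintype.card_coe]
  by_cases hs : s.card = 0
  · simp [hs]
  -- A negative base cannot occur: `exp (-weightSum)` is the probability of a prefix.
  · rcases le_or_gt 0 (1 - Real.exp (-weightSum (letterWeight β) x (l x))) with h | h
    · rw [ENNReal.ofReal_pow h]
    · have h6 : stringLaw β {y | ∃ r < l x, y r ≠ x r} = 0 := by
        rw [stringLaw_separated hβ, ENNReal.ofReal_of_nonpos h.le]
      have h7 := stringLaw_prefix hβ x (l x)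
      have h8 : stringLaw β {y | ∀ r < l x, y r = x r} ≤ 1 := prob_le_one
      rw [h7, ENNReal.ofReal_le_one] at h8
      linarith

/-- The first `k` letters already separate the two rows with probability at least `1 - exp (-γ k)`;
let `k` tend to infinity. -/
theorem ae_row_ne (hβ : ∀ b, 0 < β.real {b}) {γ : ℝ} (hγ : 0 < γ)
    (hc : ∀ b, γ ≤ letterWeight β b) (hR : ∀ j, Measurable (R j))
    (hind : iIndepFun R P) (hlaw : ∀ j, P.map (R j) = stringLaw β) {i j : ℕ} (hij : i ≠ j) :
    ∀ᵐ ω ∂P, R j ω ≠ R i ω := by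
  have key : ∀ k : ℕ, ENNReal.ofReal (1 - Real.exp (-(γ * k))) ≤ P {ω | R j ω ≠ R i ω} := by
    intro k
    calc ENNReal.ofReal (1 - Real.exp (-(γ * k)))
        = ∫⁻ _, ENNReal.ofReal (1 - Real.exp (-(γ * k))) ∂stringLaw β := by simp
      _ ≤ ∫⁻ x, ENNReal.ofReal
            ((1 - Real.exp (-weightSum (letterWeight β) x k)) ^ ({j} : Finset ℕ).card)
            ∂stringLaw β := by
          refine lintegral_mono fun x => ENNReal.ofReal_le_ofReal ?_
          rw [Finset.card_singleton, pow_one]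
          have := mul_le_weightSum hc x k
          gcongr
      _ = P {ω | ∀ j' ∈ ({j} : Finset ℕ), ∃ r < k, R j' ω r ≠ R i ω r} :=
          (measure_separated hβ hR hind hlaw (i := i) (s := {j}) (by simpa using hij) (l := fun _ => k)
            measurable_const).symm
      _ ≤ P {ω | R j ω ≠ R i ω} := by
          refine measure_mono fun ω hω h => ?_
          obtain ⟨r, -, hr⟩ := hω j (by simp)
          exact hr (congrFun h r)
  have hlim : Tendsto (fun k : ℕ => ENNReal.ofReal (1 - Real.exp (-(γ * k)))) atTop
      (nhds (ENNReal.ofReal (1 - 0))) := by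
    refine ENNReal.tendsto_ofReal (tendsto_const_nhds.sub ?_)
    exact Real.tendsto_exp_neg_atTop_nhds_zero.comp
      (tendsto_natCast_atTop_atTop.const_mul_atTop hγ)
  have h1 : P {ω | R j ω ≠ R i ω} = 1 := by
    refine le_antisymm prob_le_one ?_
    simpa using le_of_tendsto' hlim key
  have hm : MeasurableSet {ω | R j ω ≠ R i ω} :=
    (measurableSet_eq_fun (hR j) (hR i)).compl
  rw [ae_iff]
  exact (prob_compl_eq_zero_iff hm).2 h1

theorem ae_injOn_rows (hβ : ∀ b, 0 < β.real {b}) {γ : ℝ} (hγ : 0 < γ)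
    (hc : ∀ b, γ ≤ letterWeight β b) (hR : ∀ j, Measurable (R j))
    (hind : iIndepFun R P) (hlaw : ∀ j, P.map (R j) = stringLaw β) :
    ∀ᵐ ω ∂P, Function.Injective fun j => R j ω := by
  have h : ∀ᵐ ω ∂P, ∀ i j, i ≠ j → R j ω ≠ R i ω := by
    refine ae_all_iff.2 fun i => ae_all_iff.2 fun j => ?_
    by_cases hij : i = j
    · simp [hij]
    · filter_upwards [ae_row_ne hβ hγ hc hR hind hlaw hij] with ω hω _ using hω
  filter_upwards [h] with ω hω i j hij
  by_contra hne
  exact hω i j hne hij.symm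

/-- Since `(1 - q)(1 + q) ≤ 1`, Bernoulli's inequality for `(1 + q) ^ m` suffices. -/
theorem one_sub_pow_le_inv {q : ℝ} (h0 : 0 < q) (h1 : q ≤ 1) {m : ℕ} (hm : 0 < m) :
    (1 - q) ^ m ≤ 1 / (m * q) := by
  have hm' : (0 : ℝ) < m := Nat.cast_pos.2 hm
  rw [le_div_iff₀ (by positivity)]
  have hB : 1 + m * q ≤ (1 + q) ^ m := one_add_mul_le_pow (by linarith) m
  have hP : (1 - q) ^ m * (1 + q) ^ m ≤ 1 := by
    rw [← mul_pow]
    exact pow_le_one₀ (by nlinarith) (by nlinarith)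
  have h2 : 0 ≤ (1 - q) ^ m := pow_nonneg (by linarith) m
  nlinarith [mul_le_mul_of_nonneg_left hB h2]

/-- Exponential tails of the difference between the separation depth and the passage time. -/
theorem measure_tail_le (hβ : ∀ b, 0 < β.real {b}) {γ : ℝ} (hγ : 0 < γ)
    (hc : ∀ b, γ ≤ letterWeight β b) (hR : ∀ j, Measurable (R j))
    (hind : iIndepFun R P) (hlaw : ∀ j, P.map (R j) = stringLaw β) {n i : ℕ} (hn : 2 ≤ n)
    (hi : i < n) (r : ℕ) :
    P {ω | passage (letterWeight β) (Real.log n) (R i ω) + r <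
        separationDepth (fun j => R j ω) (Finset.range n) i} ≤
      ENNReal.ofReal (Real.exp (-γ * r)) ∧
    P {ω | separationDepth (fun j => R j ω) (Finset.range n) i + r <
        passage (letterWeight β) (Real.log n) (R i ω)} ≤
      ENNReal.ofReal (2 * Real.exp (-γ * r)) := by
  set c := letterWeight β
  set a := Real.log n with ha
  have hn0 : (0 : ℝ) < n := by positivity
  have hinj := ae_injOn_rows hβ hγ hc hR hind hlaw
  have hpm : Measurable (passage c a) := DependsOn.measurable_of_range (dependsOn_passage hγ hc a)
  set s := (Finset.range n).erase i with hs
  have hcard : s.card = n - 1 := by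
    rw [hs, Finset.card_erase_of_mem (Finset.mem_range.2 hi), Finset.card_range]
  have hm1 : ((n - 1 : ℕ) : ℝ) = n - 1 := by
    rw [Nat.cast_sub (by omega), Nat.cast_one]
  have hle : ∀ᵐ ω ∂P, ∀ k, separationDepth (fun j => R j ω) (Finset.range n) i ≤ k ↔
      ∀ j ∈ s, ∃ r < k, R j ω r ≠ R i ω r := by
    filter_upwards [hinj] with ω hω k
    rw [separationDepth_le_iff (hω.injOn) (Finset.mem_range.2 hi)]
    simp only [hs, Finset.mem_erase, and_imp]
    exact ⟨fun h j h1 h2 => h j h2 h1, fun h j h1 h2 => h j h2 h1⟩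
  have hw0 : ∀ x k, 0 ≤ weightSum c x k := fun x k =>
    le_trans (by positivity) (mul_le_weightSum hc x k)
  have hexp1 : ∀ x k, Real.exp (-weightSum c x k) ≤ 1 := fun x k =>
    Real.exp_le_one_iff.2 (by linarith [hw0 x k])
  constructor
  · set l : (ℕ → Bool) → ℕ := fun x => passage c a x + r
    have hl : Measurable l := hpm.add_const r
    have hms := measure_separated hβ hR hind hlaw (Finset.notMem_erase i (Finset.range n)) hl
    have hB : MeasurableSet {ω | ∀ j ∈ s, ∃ r < l (R i ω), R j ω r ≠ R i ω r} := by
      have : {ω | ∀ j ∈ s, ∃ r < l (R i ω), R j ω r ≠ R i ω r} =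
          ⋂ j ∈ s, ⋃ r, {ω | r < l (R i ω)} ∩ {ω | R j ω r = R i ω r}ᶜ := by
        ext ω; simp
      rw [this]
      refine Finset.measurableSet_biInter _ fun j _ => MeasurableSet.iUnion fun r =>
        MeasurableSet.inter ?_ ?_
      · exact measurableSet_lt measurable_const (hl.comp (hR i))
      · exact (measurableSet_eq_fun ((measurable_pi_apply r).comp (hR j))
          ((measurable_pi_apply r).comp (hR i))).compl
    calc _ = P {ω | ∀ j ∈ s, ∃ r < l (R i ω), R j ω r ≠ R i ω r}ᶜ := by
          refine measure_congr ?_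
          filter_upwards [hle] with ω hω
          have := hω (l (R i ω))
          exact propext (by
            change passage c a (R i ω) + r < _ ↔ ¬ _
            rw [← not_le]
            exact not_congr this)
      _ ≤ _ := by
          rw [prob_compl_eq_one_sub hB, hms]
          refine tsub_le_iff_left.2 ?_
          calc (1 : ENNReal) = ∫⁻ _, 1 ∂stringLaw β := by simp
            _ ≤ ∫⁻ x, (ENNReal.ofReal ((1 - Real.exp (-weightSum c x (l x))) ^ s.card) +
                ENNReal.ofReal (Real.exp (-γ * r))) ∂stringLaw β := by
              refine lintegral_mono fun x => ?_
              rw [← ENNReal.ofReal_add (pow_nonneg (by linarith [hexp1 x (l x)]) _)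
                (Real.exp_pos _).le, ← ENNReal.ofReal_one]
              refine ENNReal.ofReal_le_ofReal ?_
              have h1 := one_add_mul_le_pow (a := -Real.exp (-weightSum c x (l x)))
                (by linarith [hexp1 x (l x)]) s.card
              rw [hcard, hm1, ← sub_eq_add_neg] at h1
              rw [hcard]
              -- At `r` letters past the passage time the walk is at least `ln n + γ r`. With
              -- Bernoulli's inequality `h1` this is a union bound over the other strings.
              have h2 : n * Real.exp (-weightSum c x (l x)) ≤ Real.exp (-γ * r) := by
                rw [← Real.exp_log hn0, ← ha, ← Real.exp_add]
                refine Real.exp_le_exp.2 ?_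
                linarith [weightSum_add_le hc x (passage c a x) r, le_weightSum_passage hγ hc a x]
              nlinarith [Real.exp_pos (-weightSum c x (l x))]
            _ = _ := by rw [lintegral_add_right _ measurable_const]; simp; rfl
  -- The strict inequality `D + r < V` says exactly `D ≤ V - (r + 1)` when `r < V`; at `r` letters
  -- after that time the walk is still below level `a`.
  · set l : (ℕ → Bool) → ℕ := fun x => passage c a x - (r + 1)
    have hl : Measurable l := (measurable_of_countable fun k : ℕ => k - (r + 1)).comp hpm
    calc _ ≤ P {ω | ∀ j ∈ s, ∃ r < l (R i ω), R j ω r ≠ R i ω r} := by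
          refine measure_mono_ae ?_
          filter_upwards [hle] with ω hω h
          refine (hω (l (R i ω))).1 ?_
          have h' : separationDepth (fun j => R j ω) (Finset.range n) i + r <
            passage c a (R i ω) := h
          change _ ≤ passage c a (R i ω) - (r + 1)
          omega
      _ = _ := measure_separated hβ hR hind hlaw (Finset.notMem_erase i _) hl
      _ ≤ ∫⁻ _, ENNReal.ofReal (2 * Real.exp (-γ * r)) ∂stringLaw β := by
          refine lintegral_mono fun x => ENNReal.ofReal_le_ofReal ?_
          change (1 - Real.exp (-weightSum c x (l x))) ^ s.card ≤ _
          rw [hcard]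
          rcases lt_or_ge r (passage c a x) with hr | hr
          · refine (one_sub_pow_le_inv (Real.exp_pos _) (hexp1 x _) (by omega)).trans ?_
            have h1 : weightSum c x (l x) + γ * r ≤ a := by
              refine (weightSum_add_le hc x (l x) r).trans
                ((lt_passage_iff hγ hc a x _).1 ?_).le
              change passage c a x - (r + 1) + r < _
              omega
            -- With `n - 1 ≥ n / 2` this yields the factor 2 in the bound.
            have h2 : (1 : ℝ) ≤ n * Real.exp (-weightSum c x (l x)) * Real.exp (-γ * r) := by
              rw [← Real.exp_log hn0, ← ha, ← Real.exp_add, ← Real.exp_add, ← Real.exp_zero]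
              exact Real.exp_le_exp.2 (by linarith)
            have h3 : (2 : ℝ) ≤ n := by exact_mod_cast hn
            have h4 := Real.exp_pos (-weightSum c x (l x))
            have h5 := Real.exp_pos (-γ * r)
            rw [hm1, div_le_iff₀ (by nlinarith)]
            nlinarith [mul_pos h4 h5]
          -- The truncated subtraction gives zero letters, which separate nothing; the power
          -- vanishes because `n ≥ 2` leaves at least one other string.
          · have : l x = 0 := by
              change passage c a x - (r + 1) = 0
              omega
            rw [this, weightSum_zero, neg_zero, Real.exp_zero, sub_self,
              zero_pow (by omega)]
            positivity
      _ = _ := by simp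

theorem sum_range_odd (d : ℕ) : ∑ r ∈ Finset.range d, (2 * r + 1) = d ^ 2 := by
  induction d with
  | zero => rfl
  | succ d ih => rw [Finset.sum_range_succ, ih]; ring

/-- A discrete layer-cake formula, from `e ^ 2 = ∑ r < e, (2 r + 1)`: it turns the two tail bounds
into a second moment bound. -/
theorem ofReal_sq_sub_le (d v : ℕ) :
    ENNReal.ofReal (((d : ℝ) - v) ^ 2) ≤ ∑' r : ℕ, ENNReal.ofReal (2 * r + 1) *
      ((if v + r < d then 1 else 0) + (if d + r < v then 1 else 0)) := by
  wlog h : v ≤ d generalizing d v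
  · have := this v d (by omega)
    rw [← neg_sub, neg_sq]
    simpa only [add_comm] using this
  obtain ⟨e, rfl⟩ := Nat.exists_eq_add_of_le h
  calc ENNReal.ofReal ((((v + e : ℕ) : ℝ) - v) ^ 2)
      = ∑ r ∈ Finset.range e, ENNReal.ofReal (2 * r + 1) := by
        rw [← ENNReal.ofReal_sum_of_nonneg fun r _ => by positivity]
        congr 1
        have := sum_range_odd e
        have h2 : (∑ r ∈ Finset.range e, (2 * (r : ℝ) + 1)) = (e : ℝ) ^ 2 := by exact_mod_cast this
        rw [h2]
        push_cast
        ring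
    _ ≤ ∑ r ∈ Finset.range e, ENNReal.ofReal (2 * r + 1) *
      ((if v + r < v + e then 1 else 0) + (if v + e + r < v then 1 else 0)) := by
        refine Finset.sum_le_sum fun r hr => ?_
        have : r < e := Finset.mem_range.1 hr
        rw [if_pos (by omega), if_neg (by omega), add_zero, mul_one]
    _ ≤ _ := ENNReal.sum_le_tsum _

/-- The two tails together are at most `3 exp (-γ r)`, which is summable against `2 r + 1` with a
sum free of `n` and `i`. -/
theorem exists_lintegral_sq_sub_le (hβ : ∀ b, 0 < β.real {b}) {γ : ℝ} (hγ : 0 < γ)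
    (hc : ∀ b, γ ≤ letterWeight β b) (hR : ∀ j, Measurable (R j))
    (hind : iIndepFun R P) (hlaw : ∀ j, P.map (R j) = stringLaw β) :
    ∃ C : ℝ, 0 ≤ C ∧ ∀ n i : ℕ, 2 ≤ n → i < n →
      ∫⁻ ω, ENNReal.ofReal (((separationDepth (fun j => R j ω) (Finset.range n) i : ℝ) -
        passage (letterWeight β) (Real.log n) (R i ω)) ^ 2) ∂P ≤ ENNReal.ofReal C := by
  have hsum : Summable fun r : ℕ => (2 * (r : ℝ) + 1) * (3 * Real.exp (-γ * r)) := by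
    have h0 := Real.summable_pow_mul_exp_neg_nat_mul 0 hγ
    have h1 := Real.summable_pow_mul_exp_neg_nat_mul 1 hγ
    refine ((h1.mul_left 6).add (h0.mul_left 3)).congr fun r => ?_
    ring
  refine ⟨∑' r : ℕ, (2 * (r : ℝ) + 1) * (3 * Real.exp (-γ * r)),
    tsum_nonneg fun r => by positivity, fun n i hn hi => ?_⟩
  have hD : Measurable fun ω => separationDepth (fun j => R j ω) (Finset.range n) i :=
    measurable_separationDepth (fun j r => (measurable_pi_apply r).comp (hR j)) _ _
  have hV : Measurable fun ω => passage (letterWeight β) (Real.log n) (R i ω) :=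
    (DependsOn.measurable_of_range (dependsOn_passage hγ hc _)).comp (hR i)
  have hm1 : ∀ r : ℕ, MeasurableSet {ω | passage (letterWeight β) (Real.log n) (R i ω) + r <
      separationDepth (fun j => R j ω) (Finset.range n) i} := fun r =>
    measurableSet_lt (hV.add_const r) hD
  have hm2 : ∀ r : ℕ, MeasurableSet {ω | separationDepth (fun j => R j ω) (Finset.range n) i + r <
      passage (letterWeight β) (Real.log n) (R i ω)} := fun r =>
    measurableSet_lt (hD.add_const r) hV
  refine (lintegral_mono fun ω => ofReal_sq_sub_le _ _).trans ?_
  rw [lintegral_tsum fun r => ?_]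
  · rw [ENNReal.ofReal_tsum_of_nonneg (fun r => by positivity) hsum]
    refine ENNReal.tsum_le_tsum fun r => ?_
    rw [ENNReal.ofReal_mul (by positivity), lintegral_const_mul' _ _ ENNReal.ofReal_ne_top]
    gcongr
    rw [lintegral_add_left (Measurable.ite (hm1 r) measurable_const measurable_const)]
    have e : ∀ (p : Ω → Prop) [DecidablePred p], MeasurableSet {ω | p ω} →
        ∫⁻ ω, (if p ω then (1 : ENNReal) else 0) ∂P = P {ω | p ω} := fun p _ hp => by
      rw [← lintegral_indicator_one hp]
      refine lintegral_congr fun ω => ?_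
      simp [Set.indicator_apply]
    rw [e _ (hm1 r), e _ (hm2 r)]
    obtain ⟨t1, t2⟩ := measure_tail_le hβ hγ hc hR hind hlaw hn hi r
    refine (add_le_add t1 t2).trans_eq ?_
    rw [← ENNReal.ofReal_add (by positivity) (by positivity)]
    congr 1
    ring
  · exact (((Measurable.ite (hm1 r) measurable_const measurable_const).add
      (Measurable.ite (hm2 r) measurable_const measurable_const)).const_mul _).aemeasurable

end Rows

/-! ### Passage time versus the walk at a fixed time -/

/-- The passage time is, up to an error of order `a ^ (1 / 4)` in `L²`, an affine function of the
centred weight sum at a deterministic time. -/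
theorem exists_integral_passage_add_weightSum_sq_le {c : Bool → ℝ} {γ Γ : ℝ} (hγ : 0 < γ)
    (hc : ∀ b, γ ≤ c b) (hΓ : ∀ b, c b ≤ Γ) (β : Measure Bool) [IsProbabilityMeasure β]
    {H : ℝ} (hH : H = ∫ b, c b ∂β) :
    ∃ C : ℝ, 0 ≤ C ∧ ∀ (a : ℝ) (m : ℕ), 0 ≤ a → m * H ≤ a → a ≤ m * H + H →
      ∫ x, (H * passage c a x - a + (weightSum c x m - m * H)) ^ 2 ∂stringLaw β ≤
        C * (√a + 1) := by
  set v := Var[c; β] with hv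
  have hv0 : 0 ≤ v := variance_nonneg _ _
  have hΓ0 : 0 < Γ := hγ.trans_le ((hc true).trans (hΓ true))
  have hHγ : γ ≤ H := by
    rw [hH]
    calc γ = ∫ _, γ ∂β := by rw [integral_const, probReal_univ, one_smul]
      _ ≤ ∫ b, c b ∂β := integral_mono (integrable_const _) Integrable.of_finite hc
  have hH0 : 0 < H := hγ.trans_le hHγ
  -- This weight in the AM-GM bound for `|Y|` makes the resulting term `v e / (2 lam)` at most `H e
  -- / 2`, which the left side can absorb; the `+ 1` keeps it positive when `v = 0`.
  set lam := (v + 1) / H with hlam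
  have hlam0 : 0 < lam := by positivity
  set B := (2 / H) * (lam / 2 + (1 + v / H) / 2 + Γ + H) with hB
  have hB0 : 0 ≤ B := by positivity
  refine ⟨2 * v * B + 2 * Γ ^ 2, by positivity, fun a m ha h1 h2 => ?_⟩
  -- `s` is the AM-GM weight for `M`: since `E M² = v m` is of order at most `s ^ 2`, both resulting
  -- terms are of order `s`.
  set s := √a + 1 with hs
  have hs1 : 1 ≤ s := by linarith [Real.sqrt_nonneg a]
  have has : a ≤ s ^ 2 := by
    nlinarith [Real.sq_sqrt ha, Real.sqrt_nonneg a]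
  set K := max ⌈a / γ⌉₊ m with hK
  have hpd : DependsOn (passage c a) (Finset.range K : Set ℕ) :=
    dependsOn_range_mono (dependsOn_passage hγ hc a) (le_max_left _ _)
  have hmd : DependsOn (fun x => weightSum c x m) (Finset.range K : Set ℕ) :=
    dependsOn_range_mono (dependsOn_weightSum c m) (le_max_right _ _)
  have hwd : DependsOn (fun x => weightSum c x (passage c a x)) (Finset.range K : Set ℕ) :=
    fun x y hxy => by
      have e := hpd hxy
      have := dependsOn_range_mono (dependsOn_weightSum c (passage c a y)) (K := K)
        ((passage_le_ceil hγ hc a y).trans (le_max_left _ _)) hxy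
      simp only at this ⊢
      rw [e, this]
  set M : (ℕ → Bool) → ℝ := fun x => weightSum c x m - m * H with hM
  set Y : (ℕ → Bool) → ℝ := fun x =>
    (weightSum c x (passage c a x) - passage c a x * H) - M x with hY
  have hMd : DependsOn M (Finset.range K : Set ℕ) := fun x y hxy => by
    have := hmd hxy
    simp only at this
    simp only [hM, this]
  have hYd : DependsOn Y (Finset.range K : Set ℕ) := fun x y hxy => by
    have := hwd hxy
    simp only at this
    simp only [hY, hMd hxy]
    rw [this, hpd hxy]
  have hEM : ∫ x, M x ^ 2 ∂stringLaw β = v * m := by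
    have := integral_weightSum_sub_sq (c := c) β m
    rwa [← hH] at this
  set e := ∫ x, |(passage c a x : ℝ) - m| ∂stringLaw β with he
  have hEY : ∫ x, Y x ^ 2 ∂stringLaw β = v * e := by
    have := integral_passage_transform_sq β hγ hc a m
    rwa [← hH] at this
  have hIM : Integrable (fun x => M x ^ 2) (stringLaw β) :=
    DependsOn.integrable_of_range (k := K) fun x y hxy => by simp only [hMd hxy]
  have hIY : Integrable (fun x => Y x ^ 2) (stringLaw β) :=
    DependsOn.integrable_of_range (k := K) fun x y hxy => by simp only [hYd hxy]
  have hIp : Integrable (fun x => |(passage c a x : ℝ) - m|) (stringLaw β) :=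
    DependsOn.integrable_of_range (k := K) fun x y hxy => by simp only [hpd hxy]
  have hT : ∀ x, H * passage c a x - a + M x = -Y x + (weightSum c x (passage c a x) - a) :=
    fun x => by simp only [hY]; ring
  have hover : ∀ x, 0 ≤ weightSum c x (passage c a x) - a ∧
      weightSum c x (passage c a x) - a ≤ Γ := fun x =>
    ⟨by linarith [le_weightSum_passage hγ hc a x],
      by linarith [weightSum_passage_le hγ hc hΓ ha x]⟩
  have hamgm : ∀ t z : ℝ, 0 < t → |z| ≤ t / 2 + z ^ 2 / (2 * t) := fun t z ht => by
    rw [← sub_nonneg]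
    have : t / 2 + z ^ 2 / (2 * t) - |z| = (t - |z|) ^ 2 / (2 * t) := by
      field_simp
      rw [sub_sq, sq_abs]
      ring
    rw [this]
    positivity
  have hpt : ∀ x, H * |(passage c a x : ℝ) - m| ≤
      (lam / 2 + s / 2 + Γ + H) + ((1 / (2 * lam)) * Y x ^ 2 + (1 / (2 * s)) * M x ^ 2) := by
    intro x
    have e1 : H * ((passage c a x : ℝ) - m) =
        -Y x - M x + (weightSum c x (passage c a x) - a) + (a - m * H) := by
      simp only [hY]; ring
    have e2 : H * |(passage c a x : ℝ) - m| ≤ |Y x| + |M x| + Γ + H := by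
      rw [← abs_of_pos hH0, ← abs_mul, abs_of_pos hH0, e1]
      obtain ⟨o1, o2⟩ := hover x
      rw [abs_le]
      constructor <;>
        linarith [neg_abs_le (Y x), le_abs_self (Y x), neg_abs_le (M x), le_abs_self (M x)]
    have e3 := hamgm lam (Y x) hlam0
    have e4 := hamgm s (M x) (by linarith)
    rw [div_eq_inv_mul (Y x ^ 2), inv_eq_one_div] at e3
    rw [div_eq_inv_mul (M x ^ 2), inv_eq_one_div] at e4
    linarith
  -- A self-bounding inequality: `e` returns on the right because `E Y² = v e`.
  have hHe : H * e ≤ (lam / 2 + s / 2 + Γ + H) + ((1 / (2 * lam)) * (v * e) +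
      (1 / (2 * s)) * (v * m)) := by
    rw [he, ← integral_const_mul]
    have hI : Integrable (fun x => (1 / (2 * lam)) * Y x ^ 2 + (1 / (2 * s)) * M x ^ 2)
        (stringLaw β) := (hIY.const_mul (1 / (2 * lam))).add (hIM.const_mul (1 / (2 * s)))
    have := integral_mono (hIp.const_mul H)
      ((integrable_const (lam / 2 + s / 2 + Γ + H)).add hI) hpt
    refine this.trans_eq ?_
    simp only [Pi.add_apply]
    rw [integral_add (integrable_const _) hI, integral_const, probReal_univ, one_smul,
      integral_add (hIY.const_mul _) (hIM.const_mul _), integral_const_mul,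
      integral_const_mul, hEM, hEY]
  have he0 : 0 ≤ e := integral_nonneg fun x => abs_nonneg _
  have e1 : (1 / (2 * lam)) * (v * e) ≤ H * e / 2 := by
    have : (1 / (2 * lam)) * (v * e) = (v / (v + 1)) * (H * e / 2) := by
      rw [hlam]; field_simp
    rw [this]
    exact mul_le_of_le_one_left (by positivity) (by rw [div_le_one (by positivity)]; linarith)
  have e2 : (1 / (2 * s)) * (v * m) ≤ v / H / 2 * s := by
    have h3 : (m : ℝ) ≤ s ^ 2 / H := by
      rw [le_div_iff₀ hH0]; linarith
    calc (1 / (2 * s)) * (v * m) ≤ (1 / (2 * s)) * (v * (s ^ 2 / H)) := by gcongr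
      _ = v / H / 2 * s := by field_simp
  have heB : e ≤ B * s := by
    have h3 : H * e / 2 ≤ (lam / 2 + (1 + v / H) / 2 + Γ + H) * s := by
      have : lam / 2 + Γ + H ≤ (lam / 2 + Γ + H) * s :=
        le_mul_of_one_le_right (by positivity) hs1
      linarith
    have h4 : B * s = (2 / H) * ((lam / 2 + (1 + v / H) / 2 + Γ + H) * s) := by rw [hB]; ring
    rw [h4]
    calc e = (2 / H) * (H * e / 2) := by field_simp
      _ ≤ _ := by gcongr
  calc ∫ x, (H * passage c a x - a + M x) ^ 2 ∂stringLaw β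
      ≤ ∫ x, (2 * Y x ^ 2 + 2 * Γ ^ 2) ∂stringLaw β := by
        refine integral_mono (DependsOn.integrable_of_range (k := K) fun x y hxy => by
          simp only [hpd hxy, hMd hxy]) ((hIY.const_mul 2).add (integrable_const _)) fun x => ?_
        obtain ⟨o1, o2⟩ := hover x
        simp only [hT]
        nlinarith [sq_nonneg (Y x + (weightSum c x (passage c a x) - a)),
          mul_self_le_mul_self o1 o2]
    _ = 2 * (v * e) + 2 * Γ ^ 2 := by
        rw [integral_add (hIY.const_mul 2) (integrable_const _), integral_const_mul, hEY,
          integral_const, probReal_univ, one_smul]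
    _ ≤ 2 * (v * (B * s)) + 2 * Γ ^ 2 * s := by
        have := le_mul_of_one_le_right (show 0 ≤ 2 * Γ ^ 2 by positivity) hs1
        gcongr
    _ = _ := by ring

theorem memLp_two_of_lintegral_sq_le {Ω : Type*} [MeasurableSpace Ω]
    {P : Measure Ω} {X : Ω → ℝ} (hX : AEStronglyMeasurable X P) {C : ℝ}
    (h : ∫⁻ ω, ENNReal.ofReal (X ω ^ 2) ∂P ≤ ENNReal.ofReal C) : MemLp X 2 P := by
  refine (memLp_two_iff_integrable_sq hX).2 ⟨hX.pow 2, ?_⟩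
  rw [hasFiniteIntegral_iff_ofReal (ae_of_all _ fun ω => sq_nonneg _)]
  exact h.trans_lt ENNReal.ofReal_lt_top

theorem integral_sq_le_of_lintegral_sq_le {Ω : Type*} [MeasurableSpace Ω]
    {P : Measure Ω} {X : Ω → ℝ} (hX : AEStronglyMeasurable X P) {C : ℝ}
    (hC : 0 ≤ C) (h : ∫⁻ ω, ENNReal.ofReal (X ω ^ 2) ∂P ≤ ENNReal.ofReal C) :
    ∫ ω, X ω ^ 2 ∂P ≤ C := by
  rw [integral_eq_lintegral_of_nonneg_ae (ae_of_all _ fun ω => sq_nonneg _) (hX.pow 2)]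
  exact ENNReal.toReal_le_of_le_ofReal hC h

/-! ### The depth is nearly affine in the walk at a fixed time -/

section Rows

variable {Ω : Type*} [MeasurableSpace Ω] {P : Measure Ω} [IsProbabilityMeasure P]
  {β : Measure Bool} [IsProbabilityMeasure β] {R : ℕ → Ω → ℕ → Bool}

theorem memLp_separationDepth (hβ : ∀ b, 0 < β.real {b}) {γ : ℝ} (hγ : 0 < γ)
    (hc : ∀ b, γ ≤ letterWeight β b) (hR : ∀ j, Measurable (R j))
    (hind : iIndepFun R P) (hlaw : ∀ j, P.map (R j) = stringLaw β) {n i : ℕ} (hi : i < n) :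
    MemLp (fun ω => (separationDepth (fun j => R j ω) (Finset.range n) i : ℝ)) 2 P := by
  have hD : Measurable fun ω => separationDepth (fun j => R j ω) (Finset.range n) i :=
    measurable_separationDepth (fun j r => (measurable_pi_apply r).comp (hR j)) _ _
  rcases Nat.lt_or_ge n 2 with hn | hn
  -- With a single string there is nothing to separate; the tail bounds need two.
  · have : ∀ ω, separationDepth (fun j => R j ω) (Finset.range n) i = 0 := fun ω => by
      refine Nat.le_zero.1 (Nat.sInf_le fun j hj hji => ?_)
      rw [Finset.mem_range] at hj
      omega
    simp [this]
  · obtain ⟨C, -, h⟩ := exists_lintegral_sq_sub_le hβ hγ hc hR hind hlaw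
    have hVd := dependsOn_passage hγ hc (Real.log n)
    have hV : MemLp (fun ω => (passage (letterWeight β) (Real.log n) (R i ω) : ℝ)) 2 P := by
      have h1 : MemLp (fun x => (passage (letterWeight β) (Real.log n) x : ℝ)) 2
          (P.map (R i)) := by
        rw [hlaw]
        exact DependsOn.memLp_of_range (k := ⌈Real.log n / γ⌉₊)
          (fun x y hxy => by simp only [hVd hxy]) 2
      exact h1.comp_of_map (hR i).aemeasurable
    have hVm : Measurable fun ω => passage (letterWeight β) (Real.log n) (R i ω) :=
      (DependsOn.measurable_of_range hVd).comp (hR i)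
    have h2 := (memLp_two_of_lintegral_sq_le
      (((measurable_of_countable (Nat.cast : ℕ → ℝ)).comp hD).sub
        ((measurable_of_countable (Nat.cast : ℕ → ℝ)).comp hVm)).aestronglyMeasurable
      (h n i hn hi)).add hV
    refine h2.ae_eq (ae_of_all _ fun ω => ?_)
    simp

/-- The error is `H U + T`, with `U` the depth minus the passage time, bounded in L², and `T` the
error of the passage time. -/
theorem exists_integral_depth_add_weightSum_sq_le (hβ : ∀ b, 0 < β.real {b}) {γ Γ : ℝ}
    (hγ : 0 < γ) (hc : ∀ b, γ ≤ letterWeight β b) (hΓ : ∀ b, letterWeight β b ≤ Γ)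
    (hR : ∀ j, Measurable (R j)) (hind : iIndepFun R P) (hlaw : ∀ j, P.map (R j) = stringLaw β)
    {H : ℝ} (hH : H = ∫ b, letterWeight β b ∂β) :
    ∃ C : ℝ, 0 ≤ C ∧ ∀ n i m : ℕ, 2 ≤ n → i < n → m * H ≤ Real.log n →
      Real.log n ≤ m * H + H →
      ∫ ω, (H * (separationDepth (fun j => R j ω) (Finset.range n) i : ℝ) - Real.log n +
        (weightSum (letterWeight β) (R i ω) m - m * H)) ^ 2 ∂P ≤ C * (√(Real.log n) + 1) := by
  obtain ⟨C1, hC1, h1⟩ := exists_lintegral_sq_sub_le hβ hγ hc hR hind hlaw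
  obtain ⟨C2, hC2, h2⟩ := exists_integral_passage_add_weightSum_sq_le hγ hc hΓ β hH
  refine ⟨2 * H ^ 2 * C1 + 2 * C2, by positivity, fun n i m hn hi hm1 hm2 => ?_⟩
  set a := Real.log n with ha
  have ha0 : 0 ≤ a := Real.log_natCast_nonneg n
  set c := letterWeight β with hcdef
  have hpd := dependsOn_passage hγ hc a
  set K := max ⌈a / γ⌉₊ m with hK
  set T : (ℕ → Bool) → ℝ := fun x => H * passage c a x - a + (weightSum c x m - m * H) with hT
  have hTd : DependsOn T (Finset.range K : Set ℕ) := fun x y hxy => by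
    have e1 := dependsOn_range_mono hpd (le_max_left _ m) hxy
    have e2 := dependsOn_range_mono (dependsOn_weightSum c m) (le_max_right ⌈a / γ⌉₊ _) hxy
    simp only at e2
    simp only [hT, e1, e2]
  have hTm := DependsOn.measurable_of_range hTd
  have hVm : Measurable fun ω => passage c a (R i ω) :=
    (DependsOn.measurable_of_range hpd).comp (hR i)
  have hDm : Measurable fun ω => separationDepth (fun j => R j ω) (Finset.range n) i :=
    measurable_separationDepth (fun j r => (measurable_pi_apply r).comp (hR j)) _ _
  set U : Ω → ℝ := fun ω =>
    (separationDepth (fun j => R j ω) (Finset.range n) i : ℝ) - passage c a (R i ω) with hU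
  have hUm : AEStronglyMeasurable U P :=
    (((measurable_of_countable (Nat.cast : ℕ → ℝ)).comp hDm).sub
      ((measurable_of_countable (Nat.cast : ℕ → ℝ)).comp hVm)).aestronglyMeasurable
  have hUL := memLp_two_of_lintegral_sq_le hUm (h1 n i hn hi)
  have hUI := integral_sq_le_of_lintegral_sq_le hUm hC1 (h1 n i hn hi)
  have hTI : ∫ ω, T (R i ω) ^ 2 ∂P ≤ C2 * (√a + 1) := by
    have := integral_map (hR i).aemeasurable (f := fun x => T x ^ 2) (μ := P)
      (hTm.pow_const 2).aestronglyMeasurable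
    rw [← this, hlaw]
    exact h2 a m ha0 hm1 hm2
  have hTL : MemLp (fun ω => T (R i ω)) 2 P := by
    have h3 : MemLp T 2 (P.map (R i)) := by
      rw [hlaw]
      exact DependsOn.memLp_of_range hTd 2
    exact h3.comp_of_map (hR i).aemeasurable
  have hI1 := hUL.integrable_sq.const_mul (2 * H ^ 2)
  have hI2 := hTL.integrable_sq.const_mul 2
  have hW : MemLp (fun ω => H * U ω + T (R i ω)) 2 P := (hUL.const_mul H).add hTL
  calc _ = ∫ ω, (H * U ω + T (R i ω)) ^ 2 ∂P := by
        refine integral_congr_ae (ae_of_all _ fun ω => ?_)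
        simp only [hU, hT]
        ring
    _ ≤ ∫ ω, (2 * H ^ 2 * U ω ^ 2 + 2 * T (R i ω) ^ 2) ∂P := by
        refine integral_mono hW.integrable_sq (hI1.add hI2) fun ω => ?_
        simp only
        nlinarith [sq_nonneg (H * U ω - T (R i ω))]
    _ ≤ 2 * H ^ 2 * C1 + 2 * (C2 * (√a + 1)) := by
        rw [integral_add hI1 hI2, integral_const_mul, integral_const_mul]
        gcongr
    _ ≤ 2 * H ^ 2 * C1 * (√a + 1) + 2 * (C2 * (√a + 1)) := by
        have := le_mul_of_one_le_right (show 0 ≤ 2 * H ^ 2 * C1 by positivity)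
          (show 1 ≤ √a + 1 by linarith [Real.sqrt_nonneg a])
        gcongr
    _ = _ := by ring

end Rows

/-! ### Tools for limits in distribution and for variances -/

/-- Convergence in distribution only depends on the laws of the variables. -/
theorem tendstoInDistribution_of_map_eq {ι E Ω' : Type*} {Ω₁ Ω₂ : ι → Type*}
    [TopologicalSpace E] [MeasurableSpace E] [OpensMeasurableSpace E]
    [∀ i, MeasurableSpace (Ω₁ i)] [∀ i, MeasurableSpace (Ω₂ i)] [MeasurableSpace Ω']
    {μ₁ : (i : ι) → Measure (Ω₁ i)} [∀ i, IsProbabilityMeasure (μ₁ i)]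
    {μ₂ : (i : ι) → Measure (Ω₂ i)} [∀ i, IsProbabilityMeasure (μ₂ i)]
    {μ' : Measure Ω'} [IsProbabilityMeasure μ'] {X : (i : ι) → Ω₁ i → E}
    {Y : (i : ι) → Ω₂ i → E} {l : Filter ι} {Z : Ω' → E}
    (h : TendstoInDistribution X l Z μ₁ μ') (hY : ∀ i, AEMeasurable (Y i) (μ₂ i))
    (hlaw : ∀ i, (μ₁ i).map (X i) = (μ₂ i).map (Y i)) :
    TendstoInDistribution Y l Z μ₂ μ' where
  forall_aemeasurable := hY
  aemeasurable_limit := h.aemeasurable_limit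
  tendsto := by
    have := h.tendsto
    simpa only [hlaw] using this

theorem tendstoInDistribution_comp_tendsto {ι κ E Ω Ω' : Type*}
    [TopologicalSpace E] [MeasurableSpace E] [OpensMeasurableSpace E]
    [MeasurableSpace Ω] [MeasurableSpace Ω'] {μ : Measure Ω} [IsProbabilityMeasure μ]
    {μ' : Measure Ω'} [IsProbabilityMeasure μ'] {X : ι → Ω → E}
    {l : Filter ι} {l' : Filter κ} {Z : Ω' → E}
    (h : TendstoInDistribution X l Z (fun _ => μ) μ') {u : κ → ι} (hu : Tendsto u l' l) :
    TendstoInDistribution (fun k => X (u k)) l' Z (fun _ => μ) μ' where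
  forall_aemeasurable k := h.forall_aemeasurable (u k)
  aemeasurable_limit := h.aemeasurable_limit
  tendsto := h.tendsto.comp hu

theorem tendstoInMeasure_const {ι Ω : Type*} [MeasurableSpace Ω] (μ : Measure Ω) {l : Filter ι}
    {u : ι → ℝ} {c : ℝ} (hu : Tendsto u l (nhds c)) :
    TendstoInMeasure μ (fun i _ => u i) l (fun _ => c) := by
  rw [tendstoInMeasure_iff_dist]
  intro ε hε
  refine tendsto_const_nhds.congr' ?_
  filter_upwards [(Metric.tendsto_nhds.1 hu) ε hε] with i hi
  simp [hi.not_ge]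

/-- Markov's inequality for the squares. -/
theorem tendstoInMeasure_zero_of_integral_sq {Ω : Type*} [MeasurableSpace Ω] {P : Measure Ω}
    [IsFiniteMeasure P] {X : ℕ → Ω → ℝ} (hX : ∀ n, MemLp (X n) 2 P)
    (h : Tendsto (fun n => ∫ ω, X n ω ^ 2 ∂P) atTop (nhds 0)) :
    TendstoInMeasure P X atTop 0 := by
  rw [tendstoInMeasure_iff_measureReal_norm]
  intro ε hε
  have h2 : Tendsto (fun n => (∫ ω, X n ω ^ 2 ∂P) / ε ^ 2) atTop (nhds 0) := by
    simpa using h.div_const (ε ^ 2)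
  refine squeeze_zero (fun n => measureReal_nonneg) (fun n => ?_) h2
  rw [le_div_iff₀' (by positivity)]
  have := mul_meas_ge_le_integral_of_nonneg (ae_of_all _ fun ω => sq_nonneg (X n ω))
    (hX n).integrable_sq (ε ^ 2)
  refine le_trans (le_of_eq ?_) this
  congr 2
  ext ω
  simp only [Pi.zero_apply, sub_zero, Real.norm_eq_abs, Set.mem_ofPred_eq]
  rw [← sq_abs (X n ω), sq_le_sq₀ hε.le (abs_nonneg _)]

/-- Expand the nonnegative variances of `X + ε Y` and `X - ε Y`. -/
theorem abs_two_mul_covariance_le {Ω : Type*} [MeasurableSpace Ω] {P : Measure Ω}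
    [IsProbabilityMeasure P] {X Y : Ω → ℝ} (hX : MemLp X 2 P) (hY : MemLp Y 2 P) {ε : ℝ}
    (hε : 0 < ε) : |2 * cov[X, Y; P]| ≤ Var[X; P] / ε + ε * Var[Y; P] := by
  have h1 := variance_nonneg (fun ω => X ω + ε * Y ω) P
  have h2 := variance_nonneg (fun ω => X ω - ε * Y ω) P
  rw [variance_fun_add hX (hY.const_mul ε), variance_const_mul, covariance_const_mul_right] at h1
  rw [variance_fun_sub hX (hY.const_mul ε), variance_const_mul, covariance_const_mul_right] at h2
  have e : Var[X; P] / ε + ε * Var[Y; P] = (Var[X; P] + ε ^ 2 * Var[Y; P]) / ε := by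
    field_simp
  rw [e, le_div_iff₀ hε, ← abs_of_pos hε, ← abs_mul, abs_of_pos hε, abs_le]
  constructor <;> linarith

theorem tendsto_sqrt_add_one_div_log {C : ℝ} :
    Tendsto (fun n : ℕ => C * (√(Real.log n) + 1) / Real.log n) atTop (nhds 0) := by
  have hlog : Tendsto (fun n : ℕ => Real.log n) atTop atTop :=
    Real.tendsto_log_atTop.comp tendsto_natCast_atTop_atTop
  have h1 := (Real.tendsto_sqrt_atTop.comp hlog).inv_tendsto_atTop
  have h2 := hlog.inv_tendsto_atTop
  have h3 := (h1.add h2).const_mul C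
  rw [add_zero, mul_zero] at h3
  refine h3.congr' ?_
  filter_upwards [hlog.eventually_gt_atTop 0] with n hn
  have h4 : (√(Real.log n))⁻¹ = √(Real.log n) / Real.log n := by
    rw [Real.sqrt_div_self]
  simp only [Pi.inv_apply, Function.comp_apply, h4]
  field_simp

/-! ### From the L² estimate to the variance and the limit law -/

section Transfer

variable {Ω : Type*} [MeasurableSpace Ω] {P : Measure Ω} [IsProbabilityMeasure P]
  {D M : ℕ → Ω → ℝ} {H v C : ℝ} {m : ℕ → ℕ}

/-- Let `W` be the error `H D - ln n + M`. Then `H² Var D = Var W - 2 cov(W, M) + Var M`, where `Var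
W = O(√(ln n) + 1)` and `Var M` differs from `v ln n / H` by at most `v`. The covariance costs `Var
W / ε + ε Var M`. -/
theorem variance_isLittleO_of_integral_sq_le (hH : 0 < H) (hv : 0 ≤ v)
    (hD : ∀ n, MemLp (D n) 2 P) (hM : ∀ n, MemLp (M n) 2 P)
    (hm1 : ∀ n : ℕ, m n * H ≤ Real.log n) (hm2 : ∀ n : ℕ, Real.log n ≤ m n * H + H)
    (hVM : ∀ n, Var[M n; P] = v * m n)
    (hW : ∀ᶠ n : ℕ in atTop, ∫ ω, (H * D n ω - Real.log n + M n ω) ^ 2 ∂P ≤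
      C * (√(Real.log n) + 1)) :
    (fun n : ℕ => Var[D n; P] - v / H ^ 3 * Real.log n) =o[atTop] (fun n : ℕ => Real.log n) := by
  have hlog : Tendsto (fun n : ℕ => Real.log n) atTop atTop :=
    Real.tendsto_log_atTop.comp tendsto_natCast_atTop_atTop
  rw [isLittleO_iff]
  intro δ hδ
  -- Chosen so that `ε Var M` uses at most half of the allowed error `δ H² ln n`; the other terms
  -- fit in the other half for large `n`.
  set ε := δ * H ^ 3 / (2 * (v + 1)) with hε
  have hε0 : 0 < ε := by positivity
  have hlim : Tendsto (fun n : ℕ => (1 + 1 / ε) * (C * (√(Real.log n) + 1) / Real.log n) +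
      v * (Real.log n)⁻¹) atTop (nhds ((1 + 1 / ε) * 0 + v * 0)) :=
    (tendsto_sqrt_add_one_div_log.const_mul _).add (hlog.inv_tendsto_atTop.const_mul v)
  rw [mul_zero, mul_zero, add_zero] at hlim
  filter_upwards [hW, hlog.eventually_gt_atTop 0,
    hlim.eventually_lt_const (show 0 < δ * H ^ 2 / 2 by positivity)] with n hWn hn hsmall
  set a := Real.log n
  set W : Ω → ℝ := fun ω => H * D n ω - a + M n ω with hWdef
  have hWL : MemLp W 2 P := (((hD n).const_mul H).sub (memLp_const a)).add (hM n)
  have hVW : Var[W; P] ≤ C * (√a + 1) :=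
    (variance_le_expectation_sq hWL.aestronglyMeasurable).trans hWn
  have hVD : H ^ 2 * Var[D n; P] = Var[W; P] - 2 * cov[W, M n; P] + v * m n := by
    rw [← hVM, ← variance_fun_sub hWL (hM n), ← variance_const_mul,
      ← variance_sub_const ((hD n).const_mul H).aestronglyMeasurable a]
    congr 1
    funext ω
    simp only [hWdef]
    ring
  have hcov := abs_le.1 (abs_two_mul_covariance_le hWL (hM n) hε0)
  rw [hVM] at hcov
  have hVW0 := variance_nonneg W P
  have hma : v * m n ≤ v * (a / H) := by
    gcongr
    rw [le_div_iff₀ hH]; exact hm1 n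
  have hma2 : v * (a / H) ≤ v * m n + v := by
    have : a / H ≤ m n + 1 := by
      rw [div_le_iff₀ hH]; linarith [hm2 n]
    nlinarith
  have hεv : ε * (v * (a / H)) ≤ δ * H ^ 2 / 2 * a := by
    have e : ε * (v * (a / H)) = (v / (v + 1)) * (δ * H ^ 2 / 2 * a) := by
      rw [hε]; field_simp
    rw [e]
    exact mul_le_of_le_one_left (by positivity) (by rw [div_le_one (by positivity)]; linarith)
  have hεm : ε * (v * m n) ≤ ε * (v * (a / H)) := by gcongr
  have hdivW : Var[W; P] / ε ≤ C * (√a + 1) / ε := by gcongr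
  have hsm : (1 + 1 / ε) * (C * (√a + 1)) + v ≤ δ * H ^ 2 / 2 * a := by
    have := mul_le_mul_of_nonneg_right hsmall.le hn.le
    refine le_trans (le_of_eq ?_) this
    field_simp
  have hsplit : (1 + 1 / ε) * (C * (√a + 1)) = C * (√a + 1) + C * (√a + 1) / ε := by ring
  have key : |H ^ 2 * Var[D n; P] - v * (a / H)| ≤ δ * H ^ 2 * a := by
    rw [hVD, abs_le]
    constructor <;> linarith [hcov.1, hcov.2]
  have e : Var[D n; P] - v / H ^ 3 * a = (H ^ 2 * Var[D n; P] - v * (a / H)) / H ^ 2 := by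
    field_simp
  rw [Real.norm_eq_abs, Real.norm_eq_abs, abs_of_pos hn, e, abs_div, abs_of_pos (pow_pos hH 2),
    div_le_iff₀ (by positivity)]
  linarith

/-- The normalised depth differs from `-H⁻¹ M / √(ln n)` by `H⁻¹ / √(ln n)` times the error, which
tends to 0 in L² and hence in probability; Slutsky's theorem applies. -/
theorem tendstoInDistribution_of_integral_sq_le {Ω' : Type*} [MeasurableSpace Ω']
    {P' : Measure Ω'} [IsProbabilityMeasure P'] {Z : Ω' → ℝ} (hH : 0 < H)
    (hD : ∀ n, MemLp (D n) 2 P) (hM : ∀ n, MemLp (M n) 2 P)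
    (hW : ∀ᶠ n : ℕ in atTop, ∫ ω, (H * D n ω - Real.log n + M n ω) ^ 2 ∂P ≤
      C * (√(Real.log n) + 1))
    (hZ : TendstoInDistribution (fun (n : ℕ) ω => M n ω / √(Real.log n)) atTop Z (fun _ => P) P') :
    TendstoInDistribution (fun (n : ℕ) ω => (D n ω - H⁻¹ * Real.log n) / √(Real.log n)) atTop
      (fun ω => -H⁻¹ * Z ω) (fun _ => P) P' := by
  have hlog : Tendsto (fun n : ℕ => Real.log n) atTop atTop :=
    Real.tendsto_log_atTop.comp tendsto_natCast_atTop_atTop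
  have hcomp := hZ.continuous_comp (g := fun x => -H⁻¹ * x) (by fun_prop)
  refine tendstoInDistribution_of_tendstoInMeasure_sub _ _ hcomp ?_ fun n =>
    (((hD n).aemeasurable.sub_const _).div_const _)
  have hL : ∀ n : ℕ, MemLp (fun ω => H⁻¹ / √(Real.log n) *
      (H * D n ω - Real.log n + M n ω)) 2 P := fun n =>
    ((((hD n).const_mul H).sub (memLp_const _)).add (hM n)).const_mul _
  have hmeas := tendstoInMeasure_zero_of_integral_sq hL ?_
  · refine hmeas.congr_left fun n => ae_of_all _ fun ω => ?_
    simp only [Pi.sub_apply, Function.comp_apply]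
    field_simp
    ring
  · have h0 := (tendsto_sqrt_add_one_div_log (C := C)).const_mul (H⁻¹ ^ 2)
    rw [mul_zero] at h0
    refine squeeze_zero' (Eventually.of_forall fun n => integral_nonneg fun ω => sq_nonneg _) ?_ h0
    filter_upwards [hW, hlog.eventually_gt_atTop 0] with n hn hpos
    simp_rw [mul_pow]
    rw [integral_const_mul, div_pow, Real.sq_sqrt hpos.le]
    calc _ ≤ H⁻¹ ^ 2 / Real.log n * (C * (√(Real.log n) + 1)) := by gcongr
      _ = _ := by ring

end Transfer

/-! ### The central limit theorem for the walk -/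

section CentralLimit

variable (β : Measure Bool) [IsProbabilityMeasure β]

theorem variance_letter (c : Bool → ℝ) (r : ℕ) :
    Var[fun x : ℕ → Bool => c (x r); stringLaw β] = Var[c; β] := by
  have h := variance_map (μ := stringLaw β) (Y := fun x : ℕ → Bool => x r) (X := c)
    (measurable_of_finite c).aemeasurable (measurable_pi_apply r).aemeasurable
  rw [map_letter] at h
  exact h.symm

theorem tendstoInDistribution_weightSum (c : Bool → ℝ) {Ω' : Type*} [MeasurableSpace Ω']
    {P' : Measure Ω'} [IsProbabilityMeasure P'] {Y : Ω' → ℝ}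
    (hY : HasLaw Y (gaussianReal 0 Var[c; β].toNNReal) P') :
    TendstoInDistribution
      (fun (k : ℕ) x => (√k)⁻¹ * (weightSum c x k - k * ∫ b, c b ∂β)) atTop Y
      (fun _ => stringLaw β) P' := by
  have hmeas : ∀ r, Measurable fun x : ℕ → Bool => c (x r) := fun r =>
    (measurable_of_finite c).comp (measurable_pi_apply r)
  rw [← variance_letter β c 0] at hY
  have h := tendstoInDistribution_inv_sqrt_mul_sum_sub (P := stringLaw β)
    (X := fun r x => c (x r)) hY
    (DependsOn.memLp_of_range (k := 1) (fun x y hxy => by simp only [hxy 0 (by simp)]) 2)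
    ((iIndepFun_letter β).comp (fun _ => c) fun _ => measurable_of_finite c)
    fun r => ⟨(hmeas r).aemeasurable, (hmeas 0).aemeasurable, ?_⟩
  · simp only [integral_letter β c] at h
    exact h
  · have e : ∀ r, (stringLaw β).map (fun x : ℕ → Bool => c (x r)) = β.map c := fun r => by
      conv_rhs => rw [← map_letter β r]
      exact (Measure.map_map (measurable_of_finite c) (measurable_pi_apply r)).symm
    rw [e, e]

/-- The row may change with `n`, so the central limit theorem for one string is transferred by
equality of laws. Multiplication by `√(m n / ln n) → √(H⁻¹)` then changes the normalisation. -/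
theorem tendstoInDistribution_weightSum_log {c : Bool → ℝ} {H : ℝ} (hH : H = ∫ b, c b ∂β)
    (hH0 : 0 < H) {Ω Ω' : Type*} [MeasurableSpace Ω] {P : Measure Ω} [IsProbabilityMeasure P]
    [MeasurableSpace Ω'] {P' : Measure Ω'} [IsProbabilityMeasure P'] {Y : Ω' → ℝ}
    (hY : HasLaw Y (gaussianReal 0 Var[c; β].toNNReal) P') {R : ℕ → Ω → ℕ → Bool}
    (hR : ∀ n, Measurable (R n)) (hlaw : ∀ n, P.map (R n) = stringLaw β) {m : ℕ → ℕ}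
    (hm1 : ∀ n : ℕ, m n * H ≤ Real.log n) (hm2 : ∀ n : ℕ, Real.log n ≤ m n * H + H) :
    TendstoInDistribution
      (fun (n : ℕ) ω => (weightSum c (R n ω) (m n) - m n * H) / √(Real.log n)) atTop
      (fun ω => Y ω * √(H⁻¹)) (fun _ => P) P' := by
  have hlog : Tendsto (fun n : ℕ => Real.log n) atTop atTop :=
    Real.tendsto_log_atTop.comp tendsto_natCast_atTop_atTop
  have hratio : Tendsto (fun n => (m n : ℝ) / Real.log n) atTop (nhds H⁻¹) := by
    have hlow : Tendsto (fun n : ℕ => H⁻¹ - (Real.log n)⁻¹) atTop (nhds (H⁻¹ - 0)) :=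
      tendsto_const_nhds.sub hlog.inv_tendsto_atTop
    rw [sub_zero] at hlow
    refine tendsto_of_tendsto_of_tendsto_of_le_of_le' hlow tendsto_const_nhds ?_ ?_
    · filter_upwards [hlog.eventually_gt_atTop 0] with n hn
      rw [le_div_iff₀ hn, sub_mul, inv_mul_cancel₀ hn.ne', inv_mul_eq_div, sub_le_iff_le_add,
        div_le_iff₀ hH0]
      linarith [hm2 n]
    · filter_upwards [hlog.eventually_gt_atTop 0] with n hn
      rw [div_le_iff₀ hn, inv_mul_eq_div, le_div_iff₀ hH0]
      exact hm1 n
  have hm : Tendsto m atTop atTop := by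
    rw [← tendsto_natCast_atTop_iff (R := ℝ)]
    have h : Tendsto (fun n : ℕ => Real.log n / H - 1) atTop atTop :=
      tendsto_atTop_add_const_right _ _ (hlog.atTop_div_const hH0)
    refine tendsto_atTop_mono (fun n => ?_) h
    rw [sub_le_iff_le_add, div_le_iff₀ hH0]
    linarith [hm2 n]
  have h1 := tendstoInDistribution_comp_tendsto (tendstoInDistribution_weightSum β c hY) hm
  have hwm : ∀ k, Measurable fun x => weightSum c x k := fun k =>
    DependsOn.measurable_of_range (dependsOn_weightSum c k)
  have h2 : TendstoInDistribution
      (fun n ω => (√(m n))⁻¹ * (weightSum c (R n ω) (m n) - m n * ∫ b, c b ∂β)) atTop Y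
      (fun _ => P) P' := by
    refine tendstoInDistribution_of_map_eq h1
      (fun n => ((((hwm (m n)).comp (hR n)).sub_const _).const_mul _).aemeasurable) fun n => ?_
    rw [← hlaw n, Measure.map_map (((hwm (m n)).sub_const _).const_mul _) (hR n)]
    rfl
  have h3 := h2.continuous_comp_prodMk_of_tendstoInMeasure_const (g := fun z : ℝ × ℝ => z.1 * z.2)
    (by fun_prop) (tendstoInMeasure_const P ((Real.continuous_sqrt.tendsto _).comp hratio))
    fun n => aemeasurable_const
  refine h3.congr (fun n => ae_of_all _ fun ω => ?_) (ae_of_all _ fun ω => rfl)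
  simp only [Function.comp_apply, ← hH]
  rcases Nat.eq_zero_or_pos (m n) with h0 | h0
  · simp [h0, weightSum_zero]
  · have : 0 < √(m n : ℝ) := Real.sqrt_pos.2 (Nat.cast_pos.2 h0)
    rw [Real.sqrt_div (Nat.cast_nonneg _)]
    field_simp

end CentralLimit

/-! ### The law of a letter, and the rows of the array -/

theorem measure_bool_ext {μ ν : Measure Bool} [IsProbabilityMeasure μ] [IsProbabilityMeasure ν]
    (h : μ {true} = ν {true}) : μ = ν := by
  refine Measure.ext_of_singleton fun b => ?_
  cases b
  · have e : ({false} : Set Bool) = {true}ᶜ := by ext b; simp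
    rw [e, prob_compl_eq_one_sub (MeasurableSet.singleton _),
      prob_compl_eq_one_sub (MeasurableSet.singleton _), h]
  · exact h

theorem integral_bool (β : Measure Bool) [IsProbabilityMeasure β] (g : Bool → ℝ) :
    ∫ b, g b ∂β = β.real {true} * g true + β.real {false} * g false := by
  rw [integral_fintype Integrable.of_finite]
  simp

theorem integral_letterWeight {β : Measure Bool} [IsProbabilityMeasure β] {p : ℝ}
    (ht : β.real {true} = p) (hf : β.real {false} = 1 - p) :
    ∫ b, letterWeight β b ∂β = Real.binEntropy p := by
  rw [integral_bool, letterWeight, letterWeight, ht, hf, Real.binEntropy, Real.log_inv,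
    Real.log_inv]

theorem variance_letterWeight {β : Measure Bool} [IsProbabilityMeasure β] {p : ℝ}
    (ht : β.real {true} = p) (hf : β.real {false} = 1 - p) :
    Var[letterWeight β; β] = sigmaSq p := by
  rw [variance_eq_integral (measurable_of_finite _).aemeasurable, integral_letterWeight ht hf,
    integral_bool, letterWeight, letterWeight, ht, hf, sigmaSq, secondMoment, Real.binEntropy,
    Real.log_inv, Real.log_inv]
  ring

theorem sigmaSq_eq (p : ℝ) :
    sigmaSq p = p * (1 - p) * (Real.log p - Real.log (1 - p)) ^ 2 := by
  rw [sigmaSq, secondMoment, Real.binEntropy, Real.log_inv, Real.log_inv]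
  ring

theorem sigmaSq_pos {p : ℝ} (hp0 : 0 < p) (hp1 : p < 1) (hp : p ≠ 1 / 2) : 0 < sigmaSq p := by
  rw [sigmaSq_eq]
  have h1 : 0 < 1 - p := by linarith
  have h2 : Real.log p - Real.log (1 - p) ≠ 0 := fun h => by
    have := Real.log_injOn_pos hp0 h1 (sub_eq_zero.1 h)
    exact hp (by linarith)
  positivity

/-- Currying carries the product law over pairs `(j, k)` to the product over `j` of the product laws
over `k`. -/
theorem rows_of_letters {Ω : Type*} [MeasurableSpace Ω] {P : Measure Ω} [IsProbabilityMeasure P]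
    {β : Measure Bool} [IsProbabilityMeasure β] {ξ : ℕ → ℕ → Ω → Bool}
    (hmeas : ∀ j k, Measurable (ξ j k)) (hindep : iIndepFun (fun jk : ℕ × ℕ => ξ jk.1 jk.2) P)
    (hlaw : ∀ j k, P.map (ξ j k) = β) :
    iIndepFun (fun j ω k => ξ j k ω) P ∧
      ∀ j, P.map (fun ω k => ξ j k ω) = stringLaw β := by
  have hR : ∀ j, Measurable fun ω k => ξ j k ω := fun j => measurable_pi_lambda _ (hmeas j)
  have hRR : Measurable fun ω j k => ξ j k ω := measurable_pi_lambda _ hR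
  have h1 := (iIndepFun_iff_map_fun_eq_infinitePi_map fun jk : ℕ × ℕ => hmeas jk.1 jk.2).1 hindep
  simp_rw [hlaw] at h1
  have hjoint : P.map (fun ω j k => ξ j k ω) = Measure.infinitePi fun _ : ℕ => stringLaw β := by
    have h2 := Measure.infinitePi_map_curry (ι := ℕ) (κ := ℕ) (X := Bool) (fun _ _ => β)
    rw [← h1, Measure.map_map (MeasurableEquiv.measurable _)
      (measurable_pi_lambda _ fun jk : ℕ × ℕ => hmeas jk.1 jk.2)] at h2
    exact h2
  have hrow : ∀ j, P.map (fun ω k => ξ j k ω) = stringLaw β := fun j => by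
    rw [← Measure.infinitePi_map_eval (fun _ : ℕ => stringLaw β) j, ← hjoint,
      Measure.map_map (measurable_pi_apply j) hRR]
    rfl
  refine ⟨(iIndepFun_iff_map_fun_eq_infinitePi_map hR).2 ?_, hrow⟩
  simp_rw [hrow]
  exact hjoint

end RandomTrie

/-! ### The main theorem -/

theorem mainTheorem3 {Ω : Type*} [MeasurableSpace Ω] (P : Measure Ω) [IsProbabilityMeasure P]
    (p : ℝ) (hp0 : 0 < p) (hp1 : p < 1)
    -- `ξ j k` is the letter at position `k` of the `j`-th random string
    (ξ : ℕ → ℕ → Ω → Bool)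
    (hmeas : ∀ j k, Measurable (ξ j k))
    (hindep : iIndepFun (fun jk : ℕ × ℕ => ξ jk.1 jk.2) P)
    (hlaw : ∀ j k, P {ω | ξ j k ω = true} = ENNReal.ofReal p)
    -- the label of the given string among the first `n` strings, for example always `0`
    (i : ℕ → ℕ) (hi : ∀ n, 1 ≤ n → i n < n)
    (D : ℕ → Ω → ℝ)
    (hD : ∀ n ω, D n ω = (RandomTrie.insertionDepth (fun j k => ξ j k ω) n (i n) : ℝ)) :
    TendstoInDistribution
        (fun (n : ℕ) ω => (D n ω - (Real.binEntropy p)⁻¹ * Real.log n) / √(Real.log n))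
        atTop (id : ℝ → ℝ) (fun _ => P)
        (gaussianReal 0 (RandomTrie.sigmaSq p / Real.binEntropy p ^ 3).toNNReal) ∧
      RandomTrie.sigmaSq p = p * (1 - p) * (Real.log p - Real.log (1 - p)) ^ 2 ∧
      (p ≠ 1 / 2 →
        0 < RandomTrie.sigmaSq p ∧
        RandomTrie.AsN P D (fun n => (Real.binEntropy p)⁻¹ * Real.log n)
          (fun n => (Real.binEntropy p ^ 3)⁻¹ * RandomTrie.sigmaSq p * Real.log n)) ∧
      (∀ n, MemLp (D n) 2 P) ∧
      (fun n : ℕ => Var[D n; P] - RandomTrie.sigmaSq p / Real.binEntropy p ^ 3 * Real.log n)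
        =o[atTop] (fun n : ℕ => Real.log n) := by
  open RandomTrie in
  have hlog : Tendsto (fun n : ℕ => Real.log n) atTop atTop :=
    Real.tendsto_log_atTop.comp tendsto_natCast_atTop_atTop
  have hprob : ∀ j k, IsProbabilityMeasure (P.map (ξ j k)) := fun j k =>
    Measure.isProbabilityMeasure_map (hmeas j k).aemeasurable
  have hβtrue : ∀ j k, P.map (ξ j k) {true} = ENNReal.ofReal p := fun j k => by
    rw [Measure.map_apply (hmeas j k) (MeasurableSet.singleton _), ← hlaw j k]
    rfl
  set β := P.map (ξ 0 0)
  have hβlaw : ∀ j k, P.map (ξ j k) = β := fun j k =>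
    measure_bool_ext ((hβtrue j k).trans (hβtrue 0 0).symm)
  have ht : β.real {true} = p := by
    rw [Measure.real, hβtrue, ENNReal.toReal_ofReal hp0.le]
  have hf : β.real {false} = 1 - p := by
    have e : ({false} : Set Bool) = {true}ᶜ := by ext b; simp
    rw [e, probReal_compl_eq_one_sub (MeasurableSet.singleton _), ht]
  have hβ : ∀ b, 0 < β.real {b} := fun b => by
    cases b
    · rw [hf]; linarith
    · rw [ht]; exact hp0
  obtain ⟨hind, hrow⟩ := rows_of_letters hmeas hindep hβlaw
  set R : ℕ → Ω → ℕ → Bool := fun j ω k => ξ j k ω with hRdef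
  have hR : ∀ j, Measurable (R j) := fun j => measurable_pi_lambda _ (hmeas j)
  have hw : ∀ b, 0 < letterWeight β b := fun b => by
    rw [letterWeight, neg_pos]
    refine Real.log_neg (hβ b) ?_
    cases b
    · rw [hf]; linarith
    · rw [ht]; exact hp1
  set γ := min (letterWeight β true) (letterWeight β false)
  set Γ := max (letterWeight β true) (letterWeight β false)
  have hγ : 0 < γ := lt_min (hw _) (hw _)
  have hc : ∀ b, γ ≤ letterWeight β b := fun b => by
    cases b
    · exact min_le_right _ _
    · exact min_le_left _ _
  have hΓ : ∀ b, letterWeight β b ≤ Γ := fun b => by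
    cases b
    · exact le_max_right _ _
    · exact le_max_left _ _
  set H := Real.binEntropy p
  have hH0 : 0 < H := Real.binEntropy_pos hp0 hp1
  have hH : H = ∫ b, letterWeight β b ∂β := (integral_letterWeight ht hf).symm
  have hv : Var[letterWeight β; β] = sigmaSq p := variance_letterWeight ht hf
  have hv0 : 0 ≤ sigmaSq p := hv ▸ variance_nonneg _ _
  -- the depths
  have hDae : ∀ n, D n =ᵐ[P] fun ω =>
      (separationDepth (fun j => R j ω) (Finset.range n) (i n) : ℝ) := fun n => by
    rcases Nat.eq_zero_or_pos n with rfl | hn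
    · refine ae_of_all _ fun ω => ?_
      have : separationDepth (fun j => R j ω) (Finset.range 0) (i 0) = 0 :=
        Nat.le_zero.1 (Nat.sInf_le fun j hj => by simp at hj)
      simp only [hD, insertionDepth_zero, this]
    · filter_upwards [ae_injOn_rows hβ hγ hc hR hind hrow] with ω hω
      rw [hD]
      congr 1
      exact insertionDepth_eq_separationDepth hω.injOn (hi n hn)
  have hDL : ∀ n, MemLp (D n) 2 P := fun n => by
    rcases Nat.eq_zero_or_pos n with rfl | hn
    · have : D 0 = fun _ => 0 := funext fun ω => by simp [hD, insertionDepth_zero]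
      rw [this]
      exact memLp_const 0
    · exact (memLp_separationDepth hβ hγ hc hR hind hrow (hi n hn)).ae_eq (hDae n).symm
  -- the deterministic times
  set m : ℕ → ℕ := fun n => ⌊Real.log n / H⌋₊
  have hm1 : ∀ n : ℕ, m n * H ≤ Real.log n := fun n => by
    rw [← le_div_iff₀ hH0]
    exact Nat.floor_le (div_nonneg (Real.log_natCast_nonneg n) hH0.le)
  have hm2 : ∀ n : ℕ, Real.log n ≤ m n * H + H := fun n => by
    have := (Nat.lt_floor_add_one (Real.log n / H)).le
    rw [div_le_iff₀ hH0] at this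
    linarith
  set M : ℕ → Ω → ℝ := fun n ω => weightSum (letterWeight β) (R (i n) ω) (m n) - m n * H with hM
  have hMd : ∀ k : ℕ, DependsOn (fun x => weightSum (letterWeight β) x k - k * H)
      (Finset.range k : Set ℕ) := fun k x y hxy => by
    have := dependsOn_weightSum (letterWeight β) k hxy
    simp only at this
    simp only [this]
  have hML : ∀ n, MemLp (M n) 2 P := fun n => by
    have h : MemLp (fun x => weightSum (letterWeight β) x (m n) - m n * H) 2
        (P.map (R (i n))) := by
      rw [hrow]
      exact DependsOn.memLp_of_range (hMd _) 2
    exact h.comp_of_map (hR _).aemeasurable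
  have hVM : ∀ n, Var[M n; P] = sigmaSq p * m n := fun n => by
    have hmeasM := DependsOn.measurable_of_range (hMd (m n))
    have h1 := variance_map (μ := P) (Y := R (i n)) hmeasM.aemeasurable (hR (i n)).aemeasurable
    rw [hrow] at h1
    refine h1.symm.trans ?_
    have h2 : ∫ x, (weightSum (letterWeight β) x (m n) - m n * H) ∂stringLaw β = 0 := by
      have hint : ∀ r ∈ Finset.range (m n),
          Integrable (fun x : ℕ → Bool => letterWeight β (x r)) (stringLaw β) := fun r _ =>
        DependsOn.integrable_of_range (k := r + 1) fun x y hxy => by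
          simp only [hxy r (by simp)]
      simp only [weightSum]
      rw [integral_sub (integrable_finsetSum _ hint) (integrable_const _),
        integral_finsetSum _ hint, integral_const, probReal_univ]
      simp only [integral_letter, ← hH]
      simp
    rw [variance_of_integral_eq_zero hmeasM.aemeasurable h2, ← hv, hH]
    exact integral_weightSum_sub_sq β (m n)
  obtain ⟨C, -, hC⟩ := exists_integral_depth_add_weightSum_sq_le hβ hγ hc hΓ hR hind hrow hH
  have hW : ∀ᶠ n : ℕ in atTop, ∫ ω, (H * D n ω - Real.log n + M n ω) ^ 2 ∂P ≤
      C * (√(Real.log n) + 1) := by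
    filter_upwards [eventually_ge_atTop 2] with n hn
    refine (integral_congr_ae ?_).trans_le (hC n (i n) (m n) hn (hi n (by omega)) (hm1 n) (hm2 n))
    filter_upwards [hDae n] with ω hω
    rw [hω]
  -- The Gaussian variable `Y` stays free, so that each normalisation below can choose it to make
  -- the limit variable the identity.
  have hclt : ∀ (μ : Measure ℝ) [IsProbabilityMeasure μ] (Y : ℝ → ℝ),
      HasLaw Y (gaussianReal 0 (sigmaSq p).toNNReal) μ →
      TendstoInDistribution (fun (n : ℕ) ω => (D n ω - H⁻¹ * Real.log n) / √(Real.log n))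
        atTop (fun x => -H⁻¹ * (Y x * √(H⁻¹))) (fun _ => P) μ := fun μ _ Y hY => by
    refine tendstoInDistribution_of_integral_sq_le hH0 hDL hML hW ?_
    refine tendstoInDistribution_weightSum_log β hH hH0 ?_ (fun n => hR (i n))
      (fun n => hrow (i n)) hm1 hm2
    rwa [hv]
  have hsq : √(H⁻¹) ^ 2 = H⁻¹ := Real.sq_sqrt (by positivity)
  have hgauss : ∀ (s : NNReal) (κ : ℝ), κ ^ 2 * s = sigmaSq p →
      HasLaw (fun x => κ * x) (gaussianReal 0 (sigmaSq p).toNNReal) (gaussianReal 0 s) :=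
    fun s κ h => by
      refine ⟨by fun_prop, ?_⟩
      rw [gaussianReal_map_const_mul, mul_zero]
      congr 1
      rw [← NNReal.coe_inj, Real.coe_toNNReal _ hv0]
      exact h
  have hHs : H * √(H⁻¹) ^ 2 = 1 := by rw [hsq, mul_inv_cancel₀ hH0.ne']
  refine ⟨?_, sigmaSq_eq p, fun hp => ⟨sigmaSq_pos hp0 hp1 hp, ?_, ?_⟩, hDL,
    variance_isLittleO_of_integral_sq_le hH0 hv0 hDL hML hm1 hm2 hVM hW⟩
  -- The factor `κ = -H ^ 2 * √(H⁻¹)` solves `-H⁻¹ κ √(H⁻¹) = 1`, and `κ ^ 2 = H ^ 3` turns the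
  -- variance `σ² / H ^ 3` into `σ²`.
  · have h := hclt (gaussianReal 0 (sigmaSq p / H ^ 3).toNNReal) (fun x => (-H ^ 2 * √(H⁻¹)) * x)
      (hgauss _ _ (by
        rw [Real.coe_toNNReal _ (by positivity), mul_pow, hsq]
        field_simp))
    refine h.congr (fun n => Filter.EventuallyEq.rfl) (ae_of_all _ fun x => ?_)
    simp only [id]
    calc -H⁻¹ * (-H ^ 2 * √(H⁻¹) * x * √(H⁻¹)) = (H * √(H⁻¹) ^ 2) * x := by field_simp
      _ = x := by rw [hHs, one_mul]
  · have hpos := sigmaSq_pos hp0 hp1 hp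
    filter_upwards [hlog.eventually_gt_atTop 0] with n hn
    positivity
  · have hpos := sigmaSq_pos hp0 hp1 hp
    set τ := √((H ^ 3)⁻¹ * sigmaSq p) with hτ
    have hτ2 : τ ^ 2 = (H ^ 3)⁻¹ * sigmaSq p := Real.sq_sqrt (by positivity)
    have hτ0 : 0 < τ := Real.sqrt_pos.2 (by positivity)
    -- The extra factor `τ` is cancelled by the final division by `τ`, and `H ^ 3 * τ ^ 2 = σ²`.
    have h := (hclt (gaussianReal 0 1) (fun x => (-H ^ 2 * √(H⁻¹) * τ) * x)
      (hgauss _ _ (by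
        rw [mul_pow, mul_pow, hsq, hτ2, NNReal.coe_one]
        field_simp))).continuous_comp (g := fun x => x / τ) (by fun_prop)
    refine h.congr (fun n => ae_of_all _ fun ω => ?_) (ae_of_all _ fun x => ?_)
    · simp only [Function.comp_apply]
      rw [Real.sqrt_mul (by positivity), ← hτ, div_div, mul_comm τ]
    · simp only [Function.comp_apply, id]
      calc -H⁻¹ * (-H ^ 2 * √(H⁻¹) * τ * x * √(H⁻¹)) / τ = (H * √(H⁻¹) ^ 2) * x := by field_simp
        _ = x := by rw [hHs, one_mul]
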